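/- \textbf{Setting.} There are $n$ buyers and $k\ge 1$ sellers; an order is a subset $\gamma$ of the sellers. An order costs $c(\gamma)\in[0,1]$, with $c(\emptyset)=0$. In each round there is a random performance increase $P_i(\gamma)\in[0,1]$, with $P_i(\emptyset)=0$, and a random (integrable) externality $E_{ij}(\gamma)$ that buyer $i$ suffers when buyer $j\neq i$ orders $\gamma$, with $\sum_{j\ne i}E_{ji}(\gamma)\in[0,1]$ for all $i,\gamma$. These variables may be arbitrarily correlated within a round and are independent and identically distributed across rounds. Put $G_i(\gamma)=P_i(\gamma)-c(\gamma)$. For $\alpha\in[0,1]$ the platform charges buyer $i$, at the order profile $S=(\gamma_1,\dots,\gamma_n)$, the transaction cost $\mathcal T_i(S)=\alpha\big(\sum_{j\ne i}E_{ji}(\gamma_i)-\sum_{j\ne i}E_{ij}(\gamma_j)\big)$. The utility of buyer $i$ is $U_i(S)=G_i(\gamma_i)-\sum_{j\ne i}E_{ij}(\gamma_j)-\mathcal T_i(S)$, and her effective utility is $U^e_i(\gamma)=G_i(\gamma)-\alpha\sum_{j\neq i}E_{ji}(\gamma)$, with expectation $\bar u^e_i(\gamma)$. Let $S^*$ maximize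 the expected social welfare $\sum_i\mathbb E[U_i(S)]$, and let $\gamma_i^d$ maximize $\bar u_i^e$. Let $D_h(\gamma,\gamma')=|\gamma\,\triangle\,\gamma'|/k$. Assume closeness with a parameter $\lambda>0$: for all $i$ and $\gamma$, $$\bar u^e_i(\gamma^d_i)-\bar u^e_i(\gamma)\in\big[\lambda\big(D_h(\gamma,\gamma_i^d)-\tfrac1k\big),\ \lambda D_h(\gamma,\gamma_i^d)\big].$$ \textbf{Algorithm.} Let $T\ge2$ be the number of rounds. Every buyer $i$ runs the following zooming algorithm. Her active set $\mathcal A_i$ initially consists of one (possibly random) order. In round $t$, let $n^i_t(\gamma)$ be the number of earlier rounds in which she selected $\gamma$, let $\hat u^e_{i}(\gamma)$ be the average of the values of $U_i^e(\gamma)$ observed in those rounds ($0$ if there are none), and let $c^i_t(\gamma)=\sqrt{12\log T/(n^i_t(\gamma)+1)}$. If some order $\gamma$ is uncovered, meaning that $\lambda D_h(\gamma,\gamma')>c^i_t(\gamma')$ for all $\gamma'\in\mathcal A_i$, then she adds one arbitrary uncovered order to $\mathcal A_i$. Then she selects as $\gamma_i^t$ an order in $\mathcal A_i$ that maximizes $\hat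 u^e_i(\gamma)+2c_t^i(\gamma)$. The initialization and all choices left open may be random and may depend on the past, but not on the present or future rounds' outcomes. Let $S^t=(\gamma^t_1,\dots,\gamma^t_n)$. With utilities in round $t$ evaluated at the outcome of that round, define $$R^i_d(T)=\mathbb E\Big[\sum_{t=1}^T U^e_i(\gamma_i^d)-U^e_i(\gamma_i^t)\Big],\qquad R_w(T)=\sum_{i=1}^n\mathbb E\Big[\sum_{t=1}^T U_i(S^*)-U_i(S^t)\Big].$$ \textbf{Theorem.} There is an absolute constant $C_0>0$, and for every $\lambda>0$ there is a constant $C>0$ that depends only on $\lambda$, such that in the setting above, for all $n$, all $k\ge1$, all $T\ge 2$ and all $\alpha\in[0,1]$, $$R_w(T)\le C_0\,Tn(1-\alpha)+\sum_{i=1}^nR^i_d(T)\le C\Big(Tn(1-\alpha)+nk^2\sqrt{T\log T}+nk^3\log^2(T)\,2^{3k/4}\Big).$$ -/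

import Mathlib

open MeasureTheory ProbabilityTheory

noncomputable section

/-- An order: a subset of the `k` sellers. -/
abbrev SellerSet (k : ℕ) := Finset (Fin k)

/-- The outcome of one round: the performances `P_i(γ)` and the externalities `E_ij(γ)`
(suffered by buyer `i` when buyer `j` orders `γ`). -/
abbrev Draw (n k : ℕ) := (Fin n → SellerSet k → ℝ) × (Fin n → Fin n → SellerSet k → ℝ)

/-- Performance increase `P_i(γ)` in the outcome `x`. -/
def Draw.perf {n k : ℕ} (x : Draw n k) (i : Fin n) (γ : SellerSet k) : ℝ := x.1 i γ

/-- Externality `E_ij(γ)` suffered by `i` when `j` orders `γ`, in the outcome `x`. -/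
def Draw.ext {n k : ℕ} (x : Draw n k) (i j : Fin n) (γ : SellerSet k) : ℝ := x.2 i j γ

/-- A data market with `n` buyers and `k` sellers: the sellers' costs and the joint law of all
performances and externalities in one round. Within a round these may be arbitrarily correlated. -/
structure DataMarket (n k : ℕ) where
  /-- the cost `c(γ)` of an order -/
  cost : SellerSet k → ℝ
  /-- the joint law of one round -/
  law : Measure (Draw n k)
  isProb : IsProbabilityMeasure law
  cost_mem : ∀ γ, cost γ ∈ Set.Icc (0 : ℝ) 1
  cost_empty : cost ∅ = 0
  perf_mem : ∀ i γ, ∀ᵐ x ∂law, Draw.perf x i γ ∈ Set.Icc (0 : ℝ) 1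
  perf_empty : ∀ i, ∀ᵐ x ∂law, Draw.perf x i ∅ = 0
  ext_integrable : ∀ i j, i ≠ j → ∀ γ, Integrable (fun x => Draw.ext x i j γ) law
  /-- the total externality caused by a buyer lies in `[0,1]` -/
  ext_mem : ∀ i γ, ∀ᵐ x ∂law,
    ∑ j ∈ Finset.univ.erase i, Draw.ext x j i γ ∈ Set.Icc (0 : ℝ) 1

namespace DataMarket

variable {n k : ℕ} (M : DataMarket n k) (α : ℝ)

/-- Net gain `G_i(γ) = P_i(γ) - c(γ)`. -/
def gain (x : Draw n k) (i : Fin n) (γ : SellerSet k) : ℝ := x.perf i γ - M.cost γ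

/-- Transaction cost charged to buyer `i`: `α` times the externality that `i` causes minus the
externality that `i` suffers. -/
def transactionCost (x : Draw n k) (i : Fin n) (S : Fin n → SellerSet k) : ℝ :=
  α * (∑ j ∈ Finset.univ.erase i, x.ext j i (S i)
    - ∑ j ∈ Finset.univ.erase i, x.ext i j (S j))

/-- The (stochastic) utility `U_i(S)`. -/
def utility (x : Draw n k) (i : Fin n) (S : Fin n → SellerSet k) : ℝ :=
  M.gain x i (S i) - ∑ j ∈ Finset.univ.erase i, x.ext i j (S j) - transactionCost α x i S

/-- The (stochastic) effective utility `U^e_i(γ) = G_i(γ) - α ∑_{j ≠ i} E_ji(γ)`. -/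
def effUtility (x : Draw n k) (i : Fin n) (γ : SellerSet k) : ℝ :=
  M.gain x i γ - α * ∑ j ∈ Finset.univ.erase i, x.ext j i γ

/-- Expected utility of buyer `i`. -/
def meanUtility (i : Fin n) (S : Fin n → SellerSet k) : ℝ := ∫ x, M.utility α x i S ∂M.law

/-- Expected effective utility of buyer `i`. -/
def meanEffUtility (i : Fin n) (γ : SellerSet k) : ℝ := ∫ x, M.effUtility α x i γ ∂M.law

/-- Expected social welfare. -/
def socialWelfare (S : Fin n → SellerSet k) : ℝ := ∑ i, M.meanUtility α i S

/-- `S` maximizes the expected social welfare. -/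
def IsSocialOptimum (S : Fin n → SellerSet k) : Prop :=
  ∀ S' : Fin n → SellerSet k, M.socialWelfare α S' ≤ M.socialWelfare α S

/-- `Sd i` maximizes the expected effective utility of buyer `i`, for every `i`. -/
def IsDominantProfile (Sd : Fin n → SellerSet k) : Prop :=
  ∀ i γ, M.meanEffUtility α i γ ≤ M.meanEffUtility α i (Sd i)

end DataMarket

/-- Normalized Hamming distance of two orders. -/
def hammingD {k : ℕ} (γ γ' : SellerSet k) : ℝ := ((symmDiff γ γ').card : ℝ) / k

/-- Closeness with parameter `lam`: for every buyer, the expected gap of an order to the optimal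
order lies between `lam * (D - 1/k)` and `lam * D`, with `D` the Hamming distance of the two. -/
def DataMarket.Closeness {n k : ℕ} (M : DataMarket n k) (α lam : ℝ) (Sd : Fin n → SellerSet k) :
    Prop :=
  ∀ i γ, M.meanEffUtility α i (Sd i) - M.meanEffUtility α i γ ∈
    Set.Icc (lam * (hammingD γ (Sd i) - 1 / k)) (lam * hammingD γ (Sd i))

/-! The zooming algorithm of one buyer. Rounds are numbered `0, …, T - 1`; `a s` is the order of
the buyer in round `s`, and `r s γ` is the value of the effective utility of `γ` in round `s`. -/

/-- Number of selections of `γ` before round `t`. -/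
def pulls {k : ℕ} (a : ℕ → SellerSet k) (t : ℕ) (γ : SellerSet k) : ℕ :=
  ((Finset.range t).filter (fun s => a s = γ)).card

/-- Empirical mean of the effective utility of `γ` over the rounds before `t` in which `γ` was
selected (and `0` if there are none). -/
def empMean {k : ℕ} (a : ℕ → SellerSet k) (r : ℕ → SellerSet k → ℝ) (t : ℕ) (γ : SellerSet k) : ℝ :=
  (∑ s ∈ (Finset.range t).filter (fun s => a s = γ), r s γ) / pulls a t γ

/-- Confidence radius. -/
def confRadius {k : ℕ} (T : ℕ) (a : ℕ → SellerSet k) (t : ℕ) (γ : SellerSet k) : ℝ :=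
  Real.sqrt (12 * Real.log T / (pulls a t γ + 1))

/-- Upper confidence bound. -/
def ucb {k : ℕ} (T : ℕ) (a : ℕ → SellerSet k) (r : ℕ → SellerSet k → ℝ) (t : ℕ) (γ : SellerSet k) : ℝ :=
  empMean a r t γ + 2 * confRadius T a t γ

/-- `γ` is covered in round `t` by some order in the active set `A`. -/
def IsCovered {k : ℕ} (lam : ℝ) (T : ℕ) (a : ℕ → SellerSet k) (t : ℕ) (A : Finset (SellerSet k))
    (γ : SellerSet k) : Prop :=
  ∃ γ' ∈ A, lam * hammingD γ γ' ≤ confRadius T a t γ'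

/-- `a` is the sequence of orders that the zooming algorithm with horizon `T` selects against the
effective utilities `r`. Here `A t` is the active set at the beginning of round `t`, and `A (t + 1)`
is the active set from which the order of round `t` is selected. The initial order, the
uncovered order to be activated and the maximizer of the upper confidence bound are arbitrary. -/
structure IsZooming {k : ℕ} (lam : ℝ) (T : ℕ) (r : ℕ → SellerSet k → ℝ)
    (A : ℕ → Finset (SellerSet k)) (a : ℕ → SellerSet k) : Prop where
  init : ∃ γ, A 0 = {γ}
  activate : ∀ t < T, (∃ γ, ¬ IsCovered lam T a t (A t) γ) →
    ∃ γ, ¬ IsCovered lam T a t (A t) γ ∧ A (t + 1) = insert γ (A t)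
  keep : ∀ t < T, (∀ γ, IsCovered lam T a t (A t) γ) → A (t + 1) = A t
  select_mem : ∀ t < T, a t ∈ A (t + 1)
  select_max : ∀ t < T, ∀ γ ∈ A (t + 1), ucb T a r t γ ≤ ucb T a r t (a t)

/-- A `T`-round play of the market `M` in which all buyers use the zooming algorithm.
`X t` is the outcome of round `t`, `a t i` the order of buyer `i` in round `t`, and `A t i` the
active set of buyer `i`. The σ-algebra `ℱ t` is the information available before the outcome of
round `t`, including the randomness of the initialization and of the choices left open by the
algorithm. The outcomes are independent and identically distributed over rounds. -/
structure IsZoomingPlay {n k : ℕ} (M : DataMarket n k) (α lam : ℝ) (T : ℕ)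
    {Ω : Type*} [mΩ : MeasurableSpace Ω] (μ : Measure Ω) (ℱ : Filtration ℕ mΩ)
    (X : ℕ → Ω → Draw n k) (A : ℕ → Fin n → Ω → Finset (SellerSet k))
    (a : ℕ → Fin n → Ω → SellerSet k) : Prop where
  draw_measurable : ∀ t < T, Measurable[ℱ (t + 1)] (X t)
  draw_law : ∀ t < T, μ.map (X t) = M.law
  draw_indep : ∀ t < T, Indep (MeasurableSpace.comap (X t) inferInstance) (ℱ t) μ
  order_measurable : ∀ t < T, ∀ i γ, MeasurableSet[ℱ t] {ω | a t i ω = γ}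
  init_measurable : ∀ i B, MeasurableSet[ℱ 0] {ω | A 0 i ω = B}
  active_measurable : ∀ t < T, ∀ i B, MeasurableSet[ℱ t] {ω | A (t + 1) i ω = B}
  zooming : ∀ i ω, IsZooming lam T (fun s γ => M.effUtility α (X s ω) i γ)
    (fun t => A t i ω) (fun t => a t i ω)

/-- Online effective regret of buyer `i`, the dominant profile being `Sd`. -/
def onlineEffRegret {n k : ℕ} (M : DataMarket n k) (α : ℝ) (T : ℕ)
    {Ω : Type*} [MeasurableSpace Ω] (μ : Measure Ω)
    (X : ℕ → Ω → Draw n k) (a : ℕ → Fin n → Ω → SellerSet k) (Sd : Fin n → SellerSet k)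
    (i : Fin n) : ℝ :=
  ∫ ω, ∑ t ∈ Finset.range T,
    (M.effUtility α (X t ω) i (Sd i) - M.effUtility α (X t ω) i (a t i ω)) ∂μ

/-- Online welfare regret, the social optimum being `Sopt`. -/
def onlineWelfareRegret {n k : ℕ} (M : DataMarket n k) (α : ℝ) (T : ℕ)
    {Ω : Type*} [MeasurableSpace Ω] (μ : Measure Ω)
    (X : ℕ → Ω → Draw n k) (a : ℕ → Fin n → Ω → SellerSet k) (Sopt : Fin n → SellerSet k) : ℝ :=
  ∑ i, ∫ ω, ∑ t ∈ Finset.range T,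
    (M.utility α (X t ω) i Sopt - M.utility α (X t ω) i (fun j => a t j ω)) ∂μ

end

/-! Transaction costs cancel in the social welfare, and charging every externality to the buyer who
causes it turns welfare into the sum of the effective utilities minus `(1 - α)` times the
externalities caused. These lie in `[0,1]` per buyer, so a round loses at most `n * (1 - α)` beyond
the effective gaps (`DataMarket.socialWelfare_sub_le`). Orders are chosen before the outcome of the
round, hence regrets may be computed with means; this gives the first inequality with constant 1.

For the second, suppose that all confidence intervals of a buyer are correct. An order with gap `g`
is then selected `O(log T / g²)` times. At most `2 * k` orders are within one seller of the optimum;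
there the lower closeness bound says nothing, and each costs `O(√(T log T))`. Every other order has
gap at least `lam / k` and costs `O(k log T / lam)`, so it remains to count the active ones. An
order is activated only outside the confidence balls of the earlier ones, whose radii are at least a
constant times their gaps. Active orders at distance `d` from the optimum therefore differ pairwise
in more than `2 * ((d - 1) / 7)` sellers, and a packing argument (`card_le_of_separated`) leaves
`O(2^(3k/4))` of them for each `d`.

A confidence interval fails with probability at most `2 * 2^k / T²`, by an exponential
supermartingale (`lintegral_selected_prod_le_one`) and a union bound; this costs `6 * 2^k / T`,
which is `O(2^(3k/4))` once `T ≥ 2^(3k/4)`. For shorter horizons, and for those with `√(12 log T) <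
lam`, the trivial bound `3 * T` suffices. -/

/-! ### Packing bounds for separated families of sets -/

/-- If distinct members of a family of `d`-sets differ in more than `2 * f` points, then every
`(d - f)`-set lies in at most one of them. -/
theorem card_mul_choose_le_of_separated {k d f : ℕ} (C : Finset (SellerSet k))
    (hd : ∀ c ∈ C, c.card = d) (hf : f ≤ d)
    (hsep : ∀ c ∈ C, ∀ c' ∈ C, c ≠ c' → 2 * f < (symmDiff c c').card) :
    C.card * d.choose f ≤ k.choose (d - f) := by
  -- Two `d`-sets with a common `(d - f)`-subset differ in at most `2 * f` points.
  have hdisj : (C : Set (SellerSet k)).PairwiseDisjoint (fun c => c.powersetCard (d - f)) := by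
    intro c hc c' hc' hne
    rw [Function.onFun, Finset.disjoint_left]
    intro z hz hz'
    rw [Finset.mem_powersetCard] at hz hz'
    have h1 := hsep c hc c' hc' hne
    have h2 : z.card ≤ (c ∩ c').card := Finset.card_le_card (Finset.subset_inter hz.1 hz'.1)
    have h3 : (symmDiff c c').card = (c \ c').card + (c' \ c).card := by
      rw [symmDiff_def, Finset.sup_eq_union, Finset.card_union_of_disjoint]
      exact disjoint_sdiff_sdiff
    have h4 := Finset.card_sdiff_add_card_inter c c'
    have h5 := Finset.card_sdiff_add_card_inter c' c
    rw [Finset.inter_comm c' c] at h5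
    have h6 := hd c hc
    have h7 := hd c' hc'
    omega
  have h := Finset.card_biUnion hdisj
  have hsub : (C.biUnion fun c => c.powersetCard (d - f)) ⊆
      (Finset.univ : SellerSet k).powersetCard (d - f) := by
    intro z hz
    rw [Finset.mem_biUnion] at hz
    obtain ⟨c, _, hz⟩ := hz
    rw [Finset.mem_powersetCard] at hz ⊢
    exact ⟨Finset.subset_univ _, hz.2⟩
  have hle := Finset.card_le_card hsub
  rw [h, Finset.card_powersetCard, Finset.card_univ, Fintype.card_fin] at hle
  calc C.card * d.choose f = ∑ c ∈ C, (c.powersetCard (d - f)).card := by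
        rw [Finset.sum_congr rfl (g := fun _ => d.choose f)]
        · simp
        · intro c hc
          rw [Finset.card_powersetCard, hd c hc, Nat.choose_symm hf]
    _ ≤ _ := hle

/-- The ratio of consecutive values, read off from factorials with denominators cleared; the factor
`7 * f + 7` of `(7 * f + 7)!` cancels against `f + 1` and leaves 7. -/
theorem choose_seven_mul_succ (f : ℕ) :
    (7 * (f + 1)).choose (f + 1) *
        ((6*f+6)*(6*f+5)*(6*f+4)*(6*f+3)*(6*f+2)*(6*f+1)) =
      (7 * f).choose f * (7*((7*f+6)*(7*f+5)*(7*f+4)*(7*f+3)*(7*f+2)*(7*f+1))) := by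
  have h1 : (7 * (f+1)).choose (f+1) * (f+1).factorial * (6*f+6).factorial = (7*f+7).factorial := by
    have := Nat.choose_mul_factorial_mul_factorial (n := 7*(f+1)) (k := f+1) (by omega)
    rwa [show 7*(f+1)-(f+1) = 6*f+6 by omega, show 7*(f+1) = 7*f+7 by ring] at this
  have h2 : (7 * f).choose f * f.factorial * (6*f).factorial = (7*f).factorial := by
    have := Nat.choose_mul_factorial_mul_factorial (n := 7*f) (k := f) (by omega)
    rwa [show 7*f-f = 6*f by omega] at this
  simp only [Nat.factorial_succ] at h1
  rw [← h2] at h1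
  have hpos : 0 < (f+1) * f.factorial * (6*f).factorial := by positivity
  apply Nat.eq_of_mul_eq_mul_right hpos
  linear_combination h1

/-- Here `729 / 64 = (3/2)^6`, below the limiting ratio `7^7 / 6^6`. The inequality fails at index
0; after the shift to `x + 1` the difference has nonnegative coefficients. -/
theorem rising_products_le (x : ℝ) (hx : 0 ≤ x) :
    (729 / 64) * ((6*(x+1)+6)*(6*(x+1)+5)*(6*(x+1)+4)*(6*(x+1)+3)*(6*(x+1)+2)*(6*(x+1)+1)) ≤
      7*((7*(x+1)+6)*(7*(x+1)+5)*(7*(x+1)+4)*(7*(x+1)+3)*(7*(x+1)+2)*(7*(x+1)+1)) := by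
  rw [← sub_nonneg]
  ring_nf
  positivity

theorem choose_seven_mul_growth (g : ℕ) :
    (729 / 64) * ((7 * (g + 1)).choose (g + 1) : ℝ) ≤ ((7 * (g + 1 + 1)).choose (g + 1 + 1) : ℝ) := by
  have h := choose_seven_mul_succ (g + 1)
  generalize (7 * (g + 1)).choose (g + 1) = x at h ⊢
  generalize (7 * (g + 1 + 1)).choose (g + 1 + 1) = y at h ⊢
  have hR := congrArg (Nat.cast : ℕ → ℝ) h
  push_cast at hR
  have hPQ := rising_products_le g (Nat.cast_nonneg g)
  have hP0 : 0 < ((6*((g:ℝ)+1)+6)*(6*((g:ℝ)+1)+5)*(6*((g:ℝ)+1)+4)*(6*((g:ℝ)+1)+3)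
    *(6*((g:ℝ)+1)+2)*(6*((g:ℝ)+1)+1)) := by positivity
  refine le_of_mul_le_mul_right ?_ hP0
  rw [hR, mul_assoc, mul_left_comm]
  exact mul_le_mul_of_nonneg_left hPQ (Nat.cast_nonneg x)

/-- Each step from `f ≥ 1` on gains a factor `(3/2)^6`. The step from 0 to 1 gains only 7, and the
factor 2 makes up for it. -/
theorem three_halves_pow_le_choose_seven_mul (f : ℕ) :
    ((3:ℝ) / 2) ^ (6 * f) ≤ 2 * ((7 * f).choose f : ℝ) := by
  have key : ∀ g : ℕ, ((3:ℝ) / 2) ^ (6 * (g+1)) ≤ 2 * ((7 * (g+1)).choose (g+1) : ℝ) := by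
    intro g
    induction g with
    | zero => norm_num
    | succ g ih =>
      have h := choose_seven_mul_growth g
      have h6 : ((3:ℝ) / 2) ^ (6 * (g+1+1)) = 729 / 64 * (3/2) ^ (6 * (g+1)) := by
        rw [show 6 * (g+1+1) = 6 + 6 * (g+1) by ring, pow_add]
        norm_num
      rw [h6]
      linarith
  cases f with
  | zero => norm_num
  | succ g => exact key g

/-- The left side is one term of the binomial expansion of `(2/3 + 1)^k`. -/
theorem choose_mul_two_thirds_pow_le (k j : ℕ) :
    (k.choose j : ℝ) * (2/3) ^ j ≤ (5/3) ^ k := by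
  rcases le_or_gt j k with h | h
  · have := add_pow ((2:ℝ)/3) 1 k
    rw [show (2:ℝ)/3 + 1 = 5/3 by norm_num] at this
    rw [this]
    have h2 := Finset.single_le_sum (f := fun m => ((2:ℝ)/3)^m * 1^(k-m) * (k.choose m : ℝ))
      (s := Finset.range (k+1)) (fun i _ => by positivity) (Finset.mem_range.2 (Nat.lt_succ_of_le h))
    simp only [one_pow, mul_one] at h2 ⊢
    linarith
  · rw [Nat.choose_eq_zero_of_lt h]
    simp only [Nat.cast_zero, zero_mul]
    positivity

theorem five_thirds_pow_le (k : ℕ) : ((5:ℝ)/3) ^ k ≤ 2 ^ (3 * (k:ℝ) / 4) := by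
  have h : ((5:ℝ)/3) ≤ 2 ^ ((3:ℝ)/4) := by
    rw [show ((3:ℝ)/4) = 3 * (1/4 : ℝ) by norm_num, Real.rpow_mul (by norm_num)]
    have h0 : ((5:ℝ)/3) = ((5/3 : ℝ)^(4:ℝ))^((1:ℝ)/4) := by
      rw [← Real.rpow_mul (by norm_num)]; norm_num
    rw [h0]
    apply Real.rpow_le_rpow (by positivity) _ (by norm_num)
    norm_num
  calc ((5:ℝ)/3) ^ k ≤ (2 ^ ((3:ℝ)/4)) ^ k := by gcongr
    _ = 2 ^ (3 * (k:ℝ) / 4) := by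
      rw [← Real.rpow_natCast, ← Real.rpow_mul (by norm_num)]; ring_nf

/-- A family of `d`-sets whose members differ in more than `2 * ((d - 1) / 7)` points is
exponentially smaller than the cube. -/
theorem card_le_of_separated {k d : ℕ} (hd1 : 1 ≤ d) (C : Finset (SellerSet k))
    (hd : ∀ c ∈ C, c.card = d)
    (hsep : ∀ c ∈ C, ∀ c' ∈ C, c ≠ c' → 2 * ((d - 1) / 7) < (symmDiff c c').card) :
    (C.card : ℝ) ≤ 40 * 2 ^ (3 * (k:ℝ) / 4) := by
  -- With `d` close to `7 * f`, the growth `(3/2)^(6 * f)` of `d.choose f` offsets the weight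
  -- `(2/3)^(d - f)`, and the count is left with `(5/3)^k`.
  set f := (d - 1) / 7 with hf
  have hfd : 7 * f ≤ d := by omega
  have hdr : d - f ≤ 6 * f + 7 := by omega
  have h1 := card_mul_choose_le_of_separated C hd (f := f) (by omega) hsep
  have h1' : (C.card : ℝ) * (d.choose f) ≤ k.choose (d - f) := by exact_mod_cast h1
  have h2 := choose_mul_two_thirds_pow_le k (d - f)
  have h3 : ((7 * f).choose f : ℝ) ≤ d.choose f := by exact_mod_cast Nat.choose_le_choose f hfd
  have h4 := three_halves_pow_le_choose_seven_mul f
  have h5 : ((2:ℝ)/3) ^ (6 * f + 7) ≤ (2/3) ^ (d - f) :=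
    pow_le_pow_of_le_one (by norm_num) (by norm_num) hdr
  have h6 : ((2:ℝ)/3)^(6*f) * (3/2)^(6*f) = 1 := by
    rw [← mul_pow]; norm_num
  -- Rounding `d` down to a multiple of 7 loses at most `(2/3)^7`, the binomial estimate another
  -- factor 2; this is the source of 40.
  have h7 : (1:ℝ)/40 ≤ (d.choose f : ℝ) * (2/3)^(d-f) := by
    calc (1:ℝ)/40 ≤ (2/3)^7 / 2 := by norm_num
      _ = ((3/2)^(6*f) / 2) * (2/3)^(6*f+7) := by rw [pow_add]; linear_combination (-(2/3:ℝ)^7/2) * h6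
      _ ≤ (d.choose f : ℝ) * (2/3)^(d-f) := by gcongr; linarith
  have hp : (0:ℝ) < (2/3)^(d-f) := by positivity
  have h8 : (C.card : ℝ) * (1/40) ≤ (5/3)^k := by
    calc (C.card : ℝ) * (1/40) ≤ C.card * ((d.choose f : ℝ) * (2/3)^(d-f)) := by gcongr
      _ = (C.card * (d.choose f : ℝ)) * (2/3)^(d-f) := by ring
      _ ≤ k.choose (d - f) * (2/3)^(d-f) := by gcongr
      _ ≤ _ := h2
  have h9 := five_thirds_pow_le k
  linarith

/-! ### Hamming distance and selection counts -/

theorem hammingD_self {k : ℕ} (γ : SellerSet k) : hammingD γ γ = 0 := by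
  simp [hammingD]

theorem hammingD_comm {k : ℕ} (γ γ' : SellerSet k) : hammingD γ γ' = hammingD γ' γ := by
  rw [hammingD, hammingD, symmDiff_comm]

theorem card_symmDiff_le {k : ℕ} (γ γ' : SellerSet k) : (symmDiff γ γ').card ≤ k := by
  simpa using Finset.card_le_univ (symmDiff γ γ')

theorem hammingD_le_one {k : ℕ} (γ γ' : SellerSet k) : hammingD γ γ' ≤ 1 :=
  div_le_one_of_le₀ (by exact_mod_cast card_symmDiff_le γ γ') (Nat.cast_nonneg k)

theorem pulls_succ {k : ℕ} (a : ℕ → SellerSet k) (t : ℕ) (γ : SellerSet k) :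
    pulls a (t + 1) γ = pulls a t γ + if a t = γ then 1 else 0 := by
  unfold pulls
  rw [Finset.range_add_one, Finset.filter_insert]
  split_ifs with h
  · rw [Finset.card_insert_of_notMem (by simp)]
  · rfl

theorem pulls_le {k : ℕ} (a : ℕ → SellerSet k) (t : ℕ) (γ : SellerSet k) : pulls a t γ ≤ t := by
  simpa [pulls] using Finset.card_filter_le (Finset.range t) (fun s => a s = γ)

theorem sum_selected_eq_sum_pulls_mul {k : ℕ} (a : ℕ → SellerSet k) (T : ℕ) (g : SellerSet k → ℝ) :
    ∑ t ∈ Finset.range T, g (a t) = ∑ γ, (pulls a T γ : ℝ) * g γ := by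
  rw [← Finset.sum_fiberwise (Finset.range T) a]
  refine Finset.sum_congr rfl fun γ _ => ?_
  rw [Finset.sum_congr rfl (g := fun _ => g γ)]
  · simp [pulls]
  · intro t ht
    rw [(Finset.mem_filter.1 ht).2]

theorem log_ge_of_two_le {T : ℕ} (hT : 2 ≤ T) : 0.69 ≤ Real.log T := by
  have h := Real.log_two_gt_d9
  have h2 : Real.log 2 ≤ Real.log T := Real.log_le_log (by norm_num) (by exact_mod_cast hT)
  linarith

/-! ### The zooming algorithm when all confidence intervals are correct -/

namespace IsZooming

variable {k T : ℕ} {lam : ℝ} {r : ℕ → SellerSet k → ℝ} {A : ℕ → Finset (SellerSet k)}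
  {a : ℕ → SellerSet k}

theorem active_subset_succ (hz : IsZooming lam T r A a) {t : ℕ} (ht : t < T) :
    A t ⊆ A (t + 1) := by
  by_cases h : ∃ γ, ¬ IsCovered lam T a t (A t) γ
  · obtain ⟨γ, _, h⟩ := hz.activate t ht h
    rw [h]
    exact Finset.subset_insert _ _
  · push Not at h
    rw [hz.keep t ht h]

theorem pulls_eq_zero (hz : IsZooming lam T r A a) {t : ℕ} (ht : t ≤ T) {γ : SellerSet k}
    (hγ : γ ∉ A t) : pulls a t γ = 0 := by
  induction t with
  | zero => simp [pulls]
  | succ t ih =>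
    rw [pulls_succ, ih (by omega) fun h => hγ (hz.active_subset_succ (by omega) h), if_neg]
    rintro rfl
    exact hγ (hz.select_mem t (by omega))

theorem notMem_of_not_covered {t : ℕ} {γ : SellerSet k} {B : Finset (SellerSet k)}
    (h : ¬ IsCovered lam T a t B γ) : γ ∉ B := fun hm =>
  h ⟨γ, hm, by rw [hammingD_self, mul_zero]; exact Real.sqrt_nonneg _⟩

/-- For a long horizon a freshly activated order covers everything, so that every order is covered
when the order of the round is selected. -/
theorem covered_after_activation (hz : IsZooming lam T r A a) (hlam : 0 < lam)
    (hT : lam ≤ Real.sqrt (12 * Real.log T)) {t : ℕ} (ht : t < T) (γ : SellerSet k) :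
    IsCovered lam T a t (A (t + 1)) γ := by
  by_cases h : ∃ γ, ¬ IsCovered lam T a t (A t) γ
  · obtain ⟨x, hx, hA⟩ := hz.activate t ht h
    refine ⟨x, by simp [hA], ?_⟩
    have h0 := hz.pulls_eq_zero ht.le (notMem_of_not_covered hx)
    rw [confRadius, h0]
    simp only [Nat.cast_zero, zero_add, div_one]
    have := mul_le_mul_of_nonneg_left (hammingD_le_one γ x) hlam.le
    linarith
  · push Not at h
    rw [hz.keep t ht h]
    exact h γ

section GoodEvent

variable {u : SellerSet k → ℝ} {γd : SellerSet k}

/-- The optimal order is covered by an active `γ'`. The index of `γ'` is at least `u γ'` plus its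
radius, hence at least `u γd` by closeness; the index of the selected order is at least as large,
yet at most its mean plus three radii. -/
theorem gap_le (hz : IsZooming lam T r A a) (hlam : 0 < lam)
    (hT : lam ≤ Real.sqrt (12 * Real.log T))
    (hgood : ∀ t < T, ∀ γ, |empMean a r t γ - u γ| ≤ confRadius T a t γ)
    (hup : ∀ γ, u γd - u γ ≤ lam * hammingD γ γd) {t : ℕ} (ht : t < T) :
    u γd - u (a t) ≤ 3 * confRadius T a t (a t) := by
  obtain ⟨γ', hγ', hcov⟩ := hz.covered_after_activation hlam hT ht γd
  have h1 := hz.select_max t ht γ' hγ'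
  have h2 := abs_le.1 (hgood t ht γ')
  have h3 := abs_le.1 (hgood t ht (a t))
  have h4 := hup γ'
  rw [hammingD_comm] at h4
  unfold ucb at h1
  linarith [h2.1, h3.2]

theorem pulls_mul_gap_sq_le (hz : IsZooming lam T r A a) (hlam : 0 < lam) (hT2 : 2 ≤ T)
    (hT : lam ≤ Real.sqrt (12 * Real.log T))
    (hgood : ∀ t < T, ∀ γ, |empMean a r t γ - u γ| ≤ confRadius T a t γ)
    (hup : ∀ γ, u γd - u γ ≤ lam * hammingD γ γd) (hopt : ∀ γ, u γ ≤ u γd)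
    {t : ℕ} (ht : t ≤ T) (γ : SellerSet k) :
    (pulls a t γ : ℝ) * (u γd - u γ) ^ 2 ≤ 108 * Real.log T := by
  have hL := log_ge_of_two_le hT2
  induction t with
  | zero => simp [pulls]; linarith
  | succ t ih =>
    rw [pulls_succ]
    split_ifs with h
    -- Only a selection of `γ` raises the count, and the `+ 1` in the radius makes its denominator
    -- exactly the new count.
    · have hg := hz.gap_le hlam hT hgood hup (t := t) (by omega)
      rw [h, confRadius] at hg
      have hp : (0:ℝ) < pulls a t γ + 1 := by positivity
      have hsq : (u γd - u γ) ^ 2 ≤ 9 * (12 * Real.log T / (pulls a t γ + 1)) := by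
        have h0 : 0 ≤ u γd - u γ := sub_nonneg.2 (hopt γ)
        have hs := Real.sq_sqrt (x := 12 * Real.log T / (pulls a t γ + 1)) (by positivity)
        calc (u γd - u γ) ^ 2 ≤ (3 * √(12 * Real.log T / (pulls a t γ + 1))) ^ 2 := by gcongr
          _ = 9 * (12 * Real.log T / (pulls a t γ + 1)) := by rw [mul_pow, hs]; norm_num
      push_cast
      calc ((pulls a t γ : ℝ) + 1) * (u γd - u γ) ^ 2
          ≤ (pulls a t γ + 1) * (9 * (12 * Real.log T / (pulls a t γ + 1))) := by gcongr
        _ = 108 * Real.log T := by field_simp; norm_num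
    · simpa using ih (by omega)

/-- The radius of any order, selected or not, never drops far below its gap. The `+ 1` in the
denominator adds a squared gap of at most 9, and `108 * log T + 9 ≤ (7/2)² * 12 * log T` because
`log T ≥ 0.69`; the factor 3 would not suffice. -/
theorem gap_le_confRadius (hz : IsZooming lam T r A a) (hlam : 0 < lam) (hT2 : 2 ≤ T)
    (hT : lam ≤ Real.sqrt (12 * Real.log T))
    (hgood : ∀ t < T, ∀ γ, |empMean a r t γ - u γ| ≤ confRadius T a t γ)
    (hup : ∀ γ, u γd - u γ ≤ lam * hammingD γ γd) (hopt : ∀ γ, u γ ≤ u γd)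
    (hthree : ∀ γ, u γd - u γ ≤ 3) {t : ℕ} (ht : t ≤ T) (γ : SellerSet k) :
    (u γd - u γ) / (7 / 2) ≤ confRadius T a t γ := by
  have hL := log_ge_of_two_le hT2
  have h := hz.pulls_mul_gap_sq_le hlam hT2 hT hgood hup hopt ht γ
  have h0 : 0 ≤ u γd - u γ := sub_nonneg.2 (hopt γ)
  have h9 : (u γd - u γ) ^ 2 ≤ 9 := by nlinarith [hthree γ]
  refine Real.le_sqrt_of_sq_le ?_
  rw [le_div_iff₀ (by positivity)]
  nlinarith

/-- Of two active orders, the later one is far from the earlier one. -/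
theorem active_separated (hz : IsZooming lam T r A a) (hlam : 0 < lam) (hT2 : 2 ≤ T)
    (hT : lam ≤ Real.sqrt (12 * Real.log T))
    (hgood : ∀ t < T, ∀ γ, |empMean a r t γ - u γ| ≤ confRadius T a t γ)
    (hup : ∀ γ, u γd - u γ ≤ lam * hammingD γ γd) (hopt : ∀ γ, u γ ≤ u γd)
    (hthree : ∀ γ, u γd - u γ ≤ 3) {t : ℕ} (ht : t ≤ T) :
    ∀ γ ∈ A t, ∀ γ' ∈ A t, γ ≠ γ' →
      (u γd - u γ) / (7 / 2) < lam * hammingD γ γ' ∨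
        (u γd - u γ') / (7 / 2) < lam * hammingD γ γ' := by
  induction t with
  | zero =>
    obtain ⟨x, hx⟩ := hz.init
    intro γ hγ γ' hγ' hne
    rw [hx, Finset.mem_singleton] at hγ hγ'
    exact absurd (hγ.trans hγ'.symm) hne
  | succ t ih =>
    have hold := ih (by omega)
    by_cases h : ∃ γ, ¬ IsCovered lam T a t (A t) γ
    · obtain ⟨x, hx, hA⟩ := hz.activate t (by omega) h
      have hnew : ∀ γ ∈ A t, (u γd - u γ) / (7 / 2) < lam * hammingD x γ := by
        intro γ hγ
        by_contra hcon
        push Not at hcon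
        exact hx ⟨γ, hγ, hcon.trans
          (hz.gap_le_confRadius hlam hT2 hT hgood hup hopt hthree (by omega) γ)⟩
      intro γ hγ γ' hγ' hne
      rw [hA, Finset.mem_insert] at hγ hγ'
      rcases hγ with rfl | hγ <;> rcases hγ' with rfl | hγ'
      · exact absurd rfl hne
      · exact Or.inr (hnew γ' hγ')
      · rw [hammingD_comm]
        exact Or.inl (hnew γ hγ)
      · exact hold γ hγ γ' hγ' hne
    · push Not at h
      rw [hz.keep t (by omega) h]
      exact hold

/-- At each distance `d ≥ 1` from the optimal order there are few active orders. -/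
theorem card_active_shell_le (hz : IsZooming lam T r A a) (hlam : 0 < lam) (hT2 : 2 ≤ T)
    (hk : 1 ≤ k) (hT : lam ≤ Real.sqrt (12 * Real.log T))
    (hgood : ∀ t < T, ∀ γ, |empMean a r t γ - u γ| ≤ confRadius T a t γ)
    (hup : ∀ γ, u γd - u γ ≤ lam * hammingD γ γd)
    (hlow : ∀ γ, lam * (hammingD γ γd - 1 / k) ≤ u γd - u γ) (hopt : ∀ γ, u γ ≤ u γd)
    (hthree : ∀ γ, u γd - u γ ≤ 3) {d : ℕ} (hd : 1 ≤ d) :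
    (((A T).filter fun γ => (symmDiff γ γd).card = d).card : ℝ) ≤ 40 * 2 ^ (3 * (k:ℝ) / 4) := by
  -- Translating by `γd` turns the shell into `d`-sets and preserves symmetric differences.
  rw [← Finset.card_image_of_injective _ (symmDiff_left_injective γd)]
  refine card_le_of_separated hd _ ?_ ?_
  · intro c hc
    obtain ⟨γ, hγ, rfl⟩ := Finset.mem_image.1 hc
    exact (Finset.mem_filter.1 hγ).2
  · intro c hc c' hc' hne
    obtain ⟨γ, hγ, rfl⟩ := Finset.mem_image.1 hc
    obtain ⟨γ', hγ', rfl⟩ := Finset.mem_image.1 hc'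
    rw [Finset.mem_filter] at hγ hγ'
    have hne' : γ ≠ γ' := fun h => hne (by rw [h])
    have hs : symmDiff (symmDiff γ γd) (symmDiff γ' γd) = symmDiff γ γ' := by
      rw [symmDiff_symmDiff_symmDiff_comm, symmDiff_self, symmDiff_bot]
    have hfar : ∀ x, (symmDiff x γd).card = d → (u γd - u x) / (7 / 2) < lam * hammingD γ γ' →
        2 * ((d - 1) / 7) < (symmDiff γ γ').card := by
      intro x hx h
      have hl := hlow x
      have hk0 : (0:ℝ) < k := by exact_mod_cast hk
      unfold hammingD at hl h
      rw [hx] at hl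
      have h1 : lam * ((d:ℝ) / k - 1 / k) / (7 / 2) < lam * ((symmDiff γ γ').card / k) :=
        (by gcongr : _ ≤ (u γd - u x) / (7 / 2)).trans_lt h
      have h2 : ((d:ℝ) - 1) / (7 / 2) < (symmDiff γ γ').card := by
        have e1 : lam * ((d:ℝ) / k - 1 / k) / (7 / 2) = (lam / k) * (((d:ℝ) - 1) / (7 / 2)) := by
          ring
        have e2 : lam * (((symmDiff γ γ').card : ℝ) / k) = (lam / k) * (symmDiff γ γ').card := by
          ring
        rw [e1, e2] at h1
        exact lt_of_mul_lt_mul_left h1 (by positivity)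
      have h3 : ((d - 1 : ℕ) : ℝ) = d - 1 := by push_cast [hd]; ring
      rw [← h3] at h2
      have h4 : 2 * (d - 1) < 7 * (symmDiff γ γ').card := by
        have : (2:ℝ) * (d - 1 : ℕ) < 7 * (symmDiff γ γ').card := by linarith
        exact_mod_cast this
      omega
    simp only [hs]
    rcases hz.active_separated hlam hT2 hT hgood hup hopt hthree le_rfl γ hγ.1 γ' hγ'.1 hne'
      with h | h
    · exact hfar γ hγ.2 h
    · exact hfar γ' hγ'.2 h

theorem card_near_le (hk : 1 ≤ k) (γd : SellerSet k) :
    ((Finset.univ.filter fun γ : SellerSet k => (symmDiff γ γd).card ≤ 1).card : ℝ) ≤ 2 * k := by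
  rw [← Finset.card_image_of_injective _ (symmDiff_left_injective γd)]
  have hsub : (Finset.univ.filter fun γ : SellerSet k => (symmDiff γ γd).card ≤ 1).image
      (fun γ => symmDiff γ γd) ⊆ insert ∅ (Finset.univ.image fun i : Fin k => ({i} : SellerSet k)) := by
    intro c hc
    obtain ⟨γ, hγ, rfl⟩ := Finset.mem_image.1 hc
    have h1 := (Finset.mem_filter.1 hγ).2
    rcases Nat.le_one_iff_eq_zero_or_eq_one.1 h1 with h | h
    · rw [Finset.card_eq_zero.1 h]
      exact Finset.mem_insert_self _ _
    · obtain ⟨i, hi⟩ := Finset.card_eq_one.1 h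
      exact Finset.mem_insert_of_mem (Finset.mem_image.2 ⟨i, Finset.mem_univ _, hi.symm⟩)
  have h1 := Finset.card_le_card hsub
  have h2 := Finset.card_insert_le (∅ : SellerSet k)
    (Finset.univ.image fun i : Fin k => ({i} : SellerSet k))
  have h3 : (Finset.univ.image fun i : Fin k => ({i} : SellerSet k)).card ≤ k := by
    simpa using Finset.card_image_le (s := (Finset.univ : Finset (Fin k)))
      (f := fun i => ({i} : SellerSet k))
  exact_mod_cast (by omega : _ ≤ 2 * k)

theorem card_active_far_le (hz : IsZooming lam T r A a) (hlam : 0 < lam) (hT2 : 2 ≤ T)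
    (hk : 1 ≤ k) (hT : lam ≤ Real.sqrt (12 * Real.log T))
    (hgood : ∀ t < T, ∀ γ, |empMean a r t γ - u γ| ≤ confRadius T a t γ)
    (hup : ∀ γ, u γd - u γ ≤ lam * hammingD γ γd)
    (hlow : ∀ γ, lam * (hammingD γ γd - 1 / k) ≤ u γd - u γ) (hopt : ∀ γ, u γ ≤ u γd)
    (hthree : ∀ γ, u γd - u γ ≤ 3) :
    (((A T).filter fun γ => ¬ (symmDiff γ γd).card ≤ 1).card : ℝ) ≤
      k * (40 * 2 ^ (3 * (k:ℝ) / 4)) := by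
  have hmaps : ∀ γ ∈ (A T).filter (fun γ => ¬ (symmDiff γ γd).card ≤ 1),
      (symmDiff γ γd).card ∈ Finset.Icc 1 k := fun γ hγ => by
    have := (Finset.mem_filter.1 hγ).2
    exact Finset.mem_Icc.2 ⟨by omega, card_symmDiff_le _ _⟩
  rw [Finset.card_eq_sum_card_fiberwise hmaps]
  push_cast
  calc _ ≤ ∑ _d ∈ Finset.Icc 1 k, (40 * 2 ^ (3 * (k:ℝ) / 4) : ℝ) := by
        refine Finset.sum_le_sum fun d hd => ?_
        refine le_trans ?_ (hz.card_active_shell_le hlam hT2 hk hT hgood hup hlow hopt hthree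
          (Finset.mem_Icc.1 hd).1)
        exact_mod_cast Finset.card_le_card
          (Finset.filter_subset_filter _ (Finset.filter_subset _ _))
    _ = _ := by simp

/-- The regret of the zooming algorithm when all confidence intervals are correct. -/
theorem sum_gap_le (hz : IsZooming lam T r A a) (hlam : 0 < lam) (hT2 : 2 ≤ T)
    (hk : 1 ≤ k) (hT : lam ≤ Real.sqrt (12 * Real.log T))
    (hgood : ∀ t < T, ∀ γ, |empMean a r t γ - u γ| ≤ confRadius T a t γ)
    (hup : ∀ γ, u γd - u γ ≤ lam * hammingD γ γd)
    (hlow : ∀ γ, lam * (hammingD γ γd - 1 / k) ≤ u γd - u γ) (hopt : ∀ γ, u γ ≤ u γd)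
    (hthree : ∀ γ, u γd - u γ ≤ 3) :
    ∑ t ∈ Finset.range T, (u γd - u (a t)) ≤
      2 * k * Real.sqrt (108 * (T * Real.log T)) +
        k * (40 * 2 ^ (3 * (k:ℝ) / 4)) * (108 * Real.log T * k / lam) := by
  have hL := log_ge_of_two_le hT2
  have hk0 : (0:ℝ) < k := by exact_mod_cast hk
  have hsq := hz.pulls_mul_gap_sq_le hlam hT2 hT hgood hup hopt le_rfl
  rw [sum_selected_eq_sum_pulls_mul a T (fun γ => u γd - u γ),
    ← Finset.sum_filter_add_sum_filter_not _ (fun γ => (symmDiff γ γd).card ≤ 1)]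
  refine add_le_add ?_ ?_
  -- Near orders may have arbitrarily small gaps: with `N` selections and gap `g`, `(N * g)² = N *
  -- (N * g²) ≤ T * 108 * log T`.
  · calc _ ≤ ∑ γ ∈ Finset.univ.filter (fun γ : SellerSet k => (symmDiff γ γd).card ≤ 1),
          Real.sqrt (108 * (T * Real.log T)) := by
          refine Finset.sum_le_sum fun γ _ => Real.le_sqrt_of_sq_le ?_
          have hp : (pulls a T γ : ℝ) ≤ T := by exact_mod_cast pulls_le a T γ
          calc ((pulls a T γ : ℝ) * (u γd - u γ)) ^ 2
              = pulls a T γ * (pulls a T γ * (u γd - u γ) ^ 2) := by ring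
            _ ≤ T * (108 * Real.log T) := by
                exact mul_le_mul hp (hsq γ) (by positivity) (by positivity)
            _ = _ := by ring
      _ ≤ _ := by
          rw [Finset.sum_const, nsmul_eq_mul]
          exact mul_le_mul_of_nonneg_right (card_near_le hk γd) (Real.sqrt_nonneg _)
  -- Far orders have distance at least `2 / k`, hence gap at least `lam / k`; those that are not
  -- active were never selected.
  · have hsub : (A T).filter (fun γ => ¬ (symmDiff γ γd).card ≤ 1) ⊆
        Finset.univ.filter (fun γ : SellerSet k => ¬ (symmDiff γ γd).card ≤ 1) :=
      Finset.filter_subset_filter _ (Finset.subset_univ _)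
    rw [← Finset.sum_subset hsub]
    · calc _ ≤ ∑ γ ∈ (A T).filter (fun γ => ¬ (symmDiff γ γd).card ≤ 1),
            (108 * Real.log T * k / lam) := by
            refine Finset.sum_le_sum fun γ hγ => ?_
            have hd : 2 ≤ (symmDiff γ γd).card := by
              have := (Finset.mem_filter.1 hγ).2
              omega
            have hd' : (2:ℝ) ≤ (symmDiff γ γd).card := by exact_mod_cast hd
            have hg : lam / k ≤ u γd - u γ := by
              refine le_trans ?_ (hlow γ)
              rw [hammingD, ← sub_div, div_eq_mul_one_div]
              gcongr
              linarith
            have h0 : (0:ℝ) ≤ pulls a T γ * (u γd - u γ) :=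
              mul_nonneg (Nat.cast_nonneg _) (sub_nonneg.2 (hopt γ))
            have h1 : pulls a T γ * (u γd - u γ) * (lam / k) ≤ 108 * Real.log T := by
              calc _ ≤ pulls a T γ * (u γd - u γ) * (u γd - u γ) := by gcongr
                _ = pulls a T γ * (u γd - u γ) ^ 2 := by ring
                _ ≤ _ := hsq γ
            rw [le_div_iff₀ hlam]
            rw [← mul_div_assoc, div_le_iff₀ hk0] at h1
            exact h1
        _ ≤ _ := by
            rw [Finset.sum_const, nsmul_eq_mul]
            exact mul_le_mul_of_nonneg_right
              (hz.card_active_far_le hlam hT2 hk hT hgood hup hlow hopt hthree) (by positivity)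
    · intro γ hγ hγ'
      have : γ ∉ A T := fun h => hγ' (Finset.mem_filter.2 ⟨h, (Finset.mem_filter.1 hγ).2⟩)
      rw [hz.pulls_eq_zero le_rfl this, Nat.cast_zero, zero_mul]

end GoodEvent

end IsZooming

/-! ### Averaging over an outcome independent of a finite-valued choice -/

section Selection

theorem selected_eq_sum_indicator {Ω 𝓧 β : Type*} [Fintype β] (X : Ω → 𝓧) (b : Ω → β) (g : β → 𝓧 → ℝ) :
    (fun ω => g (b ω) (X ω)) =
      fun ω => ∑ v, {ω | b ω = v}.indicator (fun ω => g v (X ω)) ω := by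
  funext ω
  rw [Finset.sum_eq_single (b ω)]
  · simp
  · intro v _ hv
    exact Set.indicator_of_notMem (fun h => hv h.symm) _
  · simp

variable {Ω 𝓧 β : Type*} {m mΩ : MeasurableSpace Ω} [MeasurableSpace 𝓧] [Fintype β]
  {μ : Measure Ω} {X : Ω → 𝓧} {b : Ω → β} {g : β → 𝓧 → ℝ}

theorem integrable_selected (hm : m ≤ mΩ) (hX : Measurable X)
    (hb : ∀ v, MeasurableSet[m] {ω | b ω = v}) (hg : ∀ v, Integrable (g v) (μ.map X)) :
    Integrable (fun ω => g (b ω) (X ω)) μ := by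
  rw [selected_eq_sum_indicator]
  exact integrable_finsetSum _ fun v _ =>
    ((hg v).comp_measurable hX).indicator (hm _ (hb v))

/-- The choice `b` is independent of the outcome `X`, so that outcomes can be averaged first. -/
theorem integral_selected [IsProbabilityMeasure μ] (hm : m ≤ mΩ) (hX : Measurable X)
    (hind : Indep (MeasurableSpace.comap X inferInstance) m μ)
    (hb : ∀ v, MeasurableSet[m] {ω | b ω = v}) (hg : ∀ v, Integrable (g v) (μ.map X)) :
    ∫ ω, g (b ω) (X ω) ∂μ = ∫ ω, (∫ x, g (b ω) x ∂(μ.map X)) ∂μ := by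
  rw [selected_eq_sum_indicator X b g,
    selected_eq_sum_indicator (fun _ => ()) b (fun v _ => ∫ x, g v x ∂(μ.map X)),
    integral_finsetSum, integral_finsetSum]
  · refine Finset.sum_congr rfl fun v _ => ?_
    rw [integral_indicator (hm _ (hb v)), integral_indicator (hm _ (hb v)),
      hind.symm.setIntegral_eq_mul hm hX.aemeasurable (hb v) (hg v).aestronglyMeasurable,
      setIntegral_const, smul_eq_mul,
      integral_map hX.aemeasurable (hg v).aestronglyMeasurable]
  · exact fun v _ => (integrable_const _).indicator (hm _ (hb v))
  · exact fun v _ => ((hg v).comp_measurable hX).indicator (hm _ (hb v))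

theorem integrable_of_selection (hm : m ≤ mΩ) [IsProbabilityMeasure μ]
    (hb : ∀ v, MeasurableSet[m] {ω | b ω = v}) (f : β → ℝ) : Integrable (fun ω => f (b ω)) μ := by
  have := integrable_selected (μ := μ) (X := fun _ => ()) (g := fun v _ => f v) hm
    measurable_const hb (fun v => integrable_const _)
  exact this

end Selection

/-! ### Concentration along predictable sets of rounds -/

section Tail

variable {Ω 𝓧 β : Type*} [mΩ : MeasurableSpace Ω] [MeasurableSpace 𝓧] [DecidableEq β]
  {μ : Measure Ω} {ℱ : Filtration ℕ mΩ} {T : ℕ} {X : ℕ → Ω → 𝓧} {b : ℕ → Ω → β}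

theorem measurable_selected_prod (hX : ∀ t < T, Measurable[ℱ (t + 1)] (X t))
    (hb : ∀ t < T, ∀ v, MeasurableSet[ℱ t] {ω | b t ω = v}) (v : β) {h : 𝓧 → ENNReal}
    (hh : Measurable h) {t : ℕ} (ht : t ≤ T) :
    Measurable[ℱ t] fun ω => ∏ s ∈ Finset.range t, if b s ω = v then h (X s ω) else 1 := by
  refine Finset.measurable_prod _ fun s hs => ?_
  have hst : s < t := Finset.mem_range.1 hs
  exact Measurable.ite (ℱ.mono hst.le _ (hb s (by omega) v))
    (hh.comp ((hX s (by omega)).mono (ℱ.mono hst) le_rfl)) measurable_const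

/-- A product of conditionally subunit factors over a predictable set of rounds has expectation at
most one. -/
theorem lintegral_selected_prod_le_one [IsProbabilityMeasure μ]
    (hX : ∀ t < T, Measurable[ℱ (t + 1)] (X t))
    (hind : ∀ t < T, Indep (MeasurableSpace.comap (X t) inferInstance) (ℱ t) μ)
    (hb : ∀ t < T, ∀ v, MeasurableSet[ℱ t] {ω | b t ω = v}) (v : β) {h : 𝓧 → ENNReal}
    (hh : Measurable h) (hle : ∀ t < T, ∫⁻ ω, h (X t ω) ∂μ ≤ 1) {t : ℕ} (ht : t ≤ T) :
    ∫⁻ ω, ∏ s ∈ Finset.range t, (if b s ω = v then h (X s ω) else 1) ∂μ ≤ 1 := by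
  induction t with
  | zero => simp
  | succ t ih =>
    have htT : t < T := by omega
    have hW := measurable_selected_prod hX hb v hh (t := t) (by omega)
    set W : Ω → ENNReal := fun ω => ∏ s ∈ Finset.range t, if b s ω = v then h (X s ω) else 1
      with hWdef
    set B : Set Ω := {ω | b t ω = v} with hB
    have hBm : MeasurableSet[ℱ t] B := hb t htT v
    have hBm' : MeasurableSet B := ℱ.le t _ hBm
    have hXm : Measurable (X t) := (hX t htT).mono (ℱ.le _) le_rfl
    have hWm : Measurable W := hW.mono (ℱ.le t) le_rfl
    have hsplit : ∀ ω, ∏ s ∈ Finset.range (t + 1), (if b s ω = v then h (X s ω) else 1) =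
        B.indicator W ω * h (X t ω) + Bᶜ.indicator W ω := by
      intro ω
      rw [Finset.prod_range_succ]
      by_cases hω : b t ω = v
      · simp [hWdef, hB, hω]
      · simp [hWdef, hB, hω]
    calc ∫⁻ ω, ∏ s ∈ Finset.range (t + 1), (if b s ω = v then h (X s ω) else 1) ∂μ
        = ∫⁻ ω, (B.indicator W ω * h (X t ω) + Bᶜ.indicator W ω) ∂μ := by simp_rw [hsplit]
      _ = ∫⁻ ω, B.indicator W ω * h (X t ω) ∂μ + ∫⁻ ω, Bᶜ.indicator W ω ∂μ :=
          lintegral_add_right _ (hWm.indicator hBm'.compl)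
      -- The earlier factors and the decision to select `v` are known before round `t`, so the new
      -- factor is independent of them.
      _ = (∫⁻ ω, B.indicator W ω ∂μ) * (∫⁻ ω, h (X t ω) ∂μ) + ∫⁻ ω, Bᶜ.indicator W ω ∂μ := by
          congr 1
          exact lintegral_mul_eq_lintegral_mul_lintegral_of_independent_measurableSpace (ℱ.le t)
            hXm.comap_le (hind t htT).symm (hW.indicator hBm)
            (hh.comp (comap_measurable (X t)))
      _ ≤ (∫⁻ ω, B.indicator W ω ∂μ) * 1 + ∫⁻ ω, Bᶜ.indicator W ω ∂μ := by
          gcongr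
          exact hle t htT
      _ = ∫⁻ ω, W ω ∂μ := by
          rw [mul_one, lintegral_indicator hBm', lintegral_indicator hBm'.compl,
            lintegral_add_compl _ hBm']
      _ ≤ 1 := ih (by omega)

/-- Hoeffding's inequality for the sum of the outcomes in the rounds in which `v` is selected. -/
theorem measure_selected_sum_ge_le [IsProbabilityMeasure μ]
    (hX : ∀ t < T, Measurable[ℱ (t + 1)] (X t))
    (hind : ∀ t < T, Indep (MeasurableSpace.comap (X t) inferInstance) (ℱ t) μ)
    (hb : ∀ t < T, ∀ v, MeasurableSet[ℱ t] {ω | b t ω = v}) (v : β) {ξ : 𝓧 → ℝ}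
    (hξ : Measurable ξ) (hsub : ∀ t < T, HasSubgaussianMGF ξ 1 (μ.map (X t)))
    {t : ℕ} (ht : t ≤ T) (m : ℕ) (c : ℝ) (hc : 0 ≤ c) :
    μ {ω | ((Finset.range t).filter fun s => b s ω = v).card = m ∧
        m * c ≤ ∑ s ∈ (Finset.range t).filter (fun s => b s ω = v), ξ (X s ω)} ≤
      ENNReal.ofReal (Real.exp (-(m * c ^ 2 / 2))) := by
  -- For variance proxy 1 the optimal exponential tilt equals the deviation `c` itself. Fixing the
  -- number `m` of selections lets `c` depend on it without being random.
  set h : 𝓧 → ENNReal := fun x => ENNReal.ofReal (Real.exp (c * ξ x - c ^ 2 / 2)) with hdef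
  have hh : Measurable h := by fun_prop
  have hle : ∀ t < T, ∫⁻ ω, h (X t ω) ∂μ ≤ 1 := by
    intro t ht
    have hXm : Measurable (X t) := (hX t ht).mono (ℱ.le _) le_rfl
    rw [← lintegral_map hh hXm]
    have hint := (hsub t ht).integrable_exp_mul c
    have hmgf := (hsub t ht).mgf_le c
    have he : ∀ x, Real.exp (c * ξ x - c ^ 2 / 2) = Real.exp (c * ξ x) * Real.exp (-(c ^ 2 / 2)) :=
      fun x => by rw [← Real.exp_add]; ring_nf
    rw [hdef, ← ofReal_integral_eq_lintegral_ofReal]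
    · refine ENNReal.ofReal_le_one.2 ?_
      simp_rw [he]
      rw [integral_mul_const]
      calc _ ≤ Real.exp ((1 : NNReal) * c ^ 2 / 2) * Real.exp (-(c ^ 2 / 2)) := by
            gcongr
            exact hmgf
        _ = 1 := by rw [← Real.exp_add]; simp
    · simp_rw [he]
      exact hint.mul_const _
    · exact Filter.Eventually.of_forall fun x => (Real.exp_pos _).le
  have hone := lintegral_selected_prod_le_one hX hind hb v hh hle ht
  have hmeas := (measurable_selected_prod hX hb v hh ht).mono (ℱ.le t) le_rfl
  set ε : ENNReal := ENNReal.ofReal (Real.exp (m * c ^ 2 / 2)) with hε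
  have hsubset : {ω | ((Finset.range t).filter fun s => b s ω = v).card = m ∧
        m * c ≤ ∑ s ∈ (Finset.range t).filter (fun s => b s ω = v), ξ (X s ω)} ⊆
      {ω | ε ≤ ∏ s ∈ Finset.range t, if b s ω = v then h (X s ω) else 1} := by
    rintro ω ⟨h1, h2⟩
    change ε ≤ _
    rw [← Finset.prod_filter, hdef, ← ENNReal.ofReal_prod_of_nonneg fun _ _ => (Real.exp_pos _).le,
      ← Real.exp_sum, Finset.sum_sub_distrib, ← Finset.mul_sum, Finset.sum_const, h1, nsmul_eq_mul]
    refine ENNReal.ofReal_le_ofReal (Real.exp_le_exp.2 ?_)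
    nlinarith [mul_le_mul_of_nonneg_left h2 hc]
  calc _ ≤ μ {ω | ε ≤ ∏ s ∈ Finset.range t, if b s ω = v then h (X s ω) else 1} :=
        measure_mono hsubset
    _ ≤ (∫⁻ ω, ∏ s ∈ Finset.range t, (if b s ω = v then h (X s ω) else 1) ∂μ) / ε :=
        meas_ge_le_lintegral_div hmeas.aemeasurable
          (by rw [hε]; exact (ENNReal.ofReal_pos.2 (Real.exp_pos _)).ne') ENNReal.ofReal_ne_top
    _ ≤ 1 / ε := by gcongr
    _ = _ := by rw [hε, one_div, ← ENNReal.ofReal_inv_of_pos (Real.exp_pos _), ← Real.exp_neg]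

end Tail

/-! ### Integrability, ranges and welfare in one round -/

namespace DataMarket

variable {n k : ℕ} (M : DataMarket n k) {α : ℝ}

theorem measurable_perf (i : Fin n) (γ : SellerSet k) :
    Measurable fun x : Draw n k => x.perf i γ := by
  unfold Draw.perf
  fun_prop

theorem measurable_ext (i j : Fin n) (γ : SellerSet k) :
    Measurable fun x : Draw n k => x.ext i j γ := by
  unfold Draw.ext
  fun_prop

theorem measurable_effUtility (i : Fin n) (γ : SellerSet k) :
    Measurable fun x => M.effUtility α x i γ := by
  unfold effUtility gain
  have h1 := measurable_perf i γ
  have h2 := fun j => measurable_ext j i γ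
  fun_prop

theorem integrable_gain (i : Fin n) (γ : SellerSet k) :
    Integrable (fun x => M.gain x i γ) M.law := by
  have := M.isProb
  exact (Integrable.of_mem_Icc 0 1 (measurable_perf i γ).aemeasurable (M.perf_mem i γ)).sub
    (integrable_const _)

theorem integrable_caused (i : Fin n) (γ : SellerSet k) :
    Integrable (fun x : Draw n k => ∑ j ∈ Finset.univ.erase i, x.ext j i γ) M.law :=
  integrable_finsetSum _ fun j hj => M.ext_integrable j i (Finset.ne_of_mem_erase hj) γ

theorem integrable_suffered (i : Fin n) (S : Fin n → SellerSet k) :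
    Integrable (fun x : Draw n k => ∑ j ∈ Finset.univ.erase i, x.ext i j (S j)) M.law :=
  integrable_finsetSum _ fun j hj => M.ext_integrable i j (Finset.ne_of_mem_erase hj).symm _

theorem integrable_effUtility (i : Fin n) (γ : SellerSet k) :
    Integrable (fun x => M.effUtility α x i γ) M.law :=
  (M.integrable_gain i γ).sub ((M.integrable_caused i γ).const_mul α)

theorem integrable_utility (i : Fin n) (S : Fin n → SellerSet k) :
    Integrable (fun x => M.utility α x i S) M.law :=
  ((M.integrable_gain i (S i)).sub (M.integrable_suffered i S)).sub
    (((M.integrable_caused i (S i)).sub (M.integrable_suffered i S)).const_mul α)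

theorem effUtility_mem (hα : α ∈ Set.Icc (0 : ℝ) 1) (i : Fin n) (γ : SellerSet k) :
    ∀ᵐ x ∂M.law, M.effUtility α x i γ ∈ Set.Icc (-1 - M.cost γ) (1 - M.cost γ) := by
  filter_upwards [M.perf_mem i γ, M.ext_mem i γ] with x h1 h2
  have h3 := mul_nonneg hα.1 h2.1
  have h4 := mul_le_one₀ hα.2 h2.1 h2.2
  have h5 := h1.1
  have h6 := h1.2
  unfold effUtility gain
  constructor <;> linarith

theorem meanEffUtility_mem (hα : α ∈ Set.Icc (0 : ℝ) 1) (i : Fin n) (γ : SellerSet k) :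
    M.meanEffUtility α i γ ∈ Set.Icc (-1 - M.cost γ) (1 - M.cost γ) := by
  have := M.isProb
  exact (convex_Icc _ _).integral_mem isClosed_Icc (M.effUtility_mem hα i γ)
    (M.integrable_effUtility i γ)

theorem gap_le_three (hα : α ∈ Set.Icc (0 : ℝ) 1) (i : Fin n) (γ γ' : SellerSet k) :
    M.meanEffUtility α i γ - M.meanEffUtility α i γ' ≤ 3 := by
  have h1 := (M.meanEffUtility_mem hα i γ).2
  have h2 := (M.meanEffUtility_mem hα i γ').1
  have h3 := (M.cost_mem γ).1
  have h4 := (M.cost_mem γ').2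
  linarith

/-- Hoeffding's lemma: the cost only translates the range, an interval of length 2. -/
theorem hasSubgaussianMGF_effUtility (hα : α ∈ Set.Icc (0 : ℝ) 1) (i : Fin n) (γ : SellerSet k) :
    HasSubgaussianMGF (fun x => M.effUtility α x i γ - M.meanEffUtility α i γ) 1 M.law := by
  have := M.isProb
  have h := hasSubgaussianMGF_of_mem_Icc (M.measurable_effUtility i γ).aemeasurable
    (M.effUtility_mem hα i γ)
  have e : ((‖(1 - M.cost γ) - (-1 - M.cost γ)‖₊ / 2) ^ 2 : NNReal) = 1 := by
    rw [show (1 - M.cost γ) - (-1 - M.cost γ) = 2 by ring]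
    simp
  rwa [e] at h

/-- The transaction costs cancel, and every externality is charged to the buyer who causes it. -/
theorem sum_utility (x : Draw n k) (S : Fin n → SellerSet k) :
    ∑ i, M.utility α x i S = ∑ i, (M.effUtility α x i (S i)
      - (1 - α) * ∑ j ∈ Finset.univ.erase i, x.ext j i (S i)) := by
  have hswap : ∑ i, ∑ j ∈ Finset.univ.erase i, x.ext i j (S j) =
      ∑ i, ∑ j ∈ Finset.univ.erase i, x.ext j i (S i) :=
    Finset.sum_comm' (by simp [eq_comm])
  simp only [utility, transactionCost, effUtility, Finset.sum_sub_distrib, ← Finset.mul_sum, hswap]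
  ring

theorem socialWelfare_eq (S : Fin n → SellerSet k) :
    M.socialWelfare α S = ∑ i, (M.meanEffUtility α i (S i)
      - (1 - α) * ∫ x, ∑ j ∈ Finset.univ.erase i, x.ext j i (S i) ∂M.law) := by
  unfold socialWelfare meanUtility
  rw [← integral_finsetSum _ fun i _ => M.integrable_utility i S]
  simp_rw [M.sum_utility]
  have hint : ∀ i ∈ (Finset.univ : Finset (Fin n)), Integrable (fun x => M.effUtility α x i (S i)
      - (1 - α) * ∑ j ∈ Finset.univ.erase i, x.ext j i (S i)) M.law := fun i _ =>
    (M.integrable_effUtility i (S i)).sub ((M.integrable_caused i (S i)).const_mul _)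
  rw [integral_finsetSum _ hint]
  refine Finset.sum_congr rfl fun i _ => ?_
  rw [integral_sub (M.integrable_effUtility i (S i)) ((M.integrable_caused i (S i)).const_mul _),
    integral_const_mul, meanEffUtility]

/-- Passing from welfare to effective utilities costs at most `1 - α` per buyer, as mean caused
externalities lie in `[0,1]`; the effective utility of `S i` is then at most that of `Sd i`. -/
theorem socialWelfare_sub_le (hα : α ∈ Set.Icc (0 : ℝ) 1) {Sd : Fin n → SellerSet k}
    (hSd : M.IsDominantProfile α Sd) (S S' : Fin n → SellerSet k) :
    M.socialWelfare α S - M.socialWelfare α S' ≤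
      n * (1 - α) + ∑ i, (M.meanEffUtility α i (Sd i) - M.meanEffUtility α i (S' i)) := by
  have := M.isProb
  have hmem : ∀ i γ, ∫ x, ∑ j ∈ Finset.univ.erase i, x.ext j i γ ∂M.law ∈ Set.Icc (0 : ℝ) 1 :=
    fun i γ => (convex_Icc _ _).integral_mem isClosed_Icc (M.ext_mem i γ) (M.integrable_caused i γ)
  rw [socialWelfare_eq, socialWelfare_eq, ← Finset.sum_sub_distrib]
  have hn : (n : ℝ) * (1 - α) = ∑ _i : Fin n, (1 - α) := by simp [mul_sub]
  rw [hn, ← Finset.sum_add_distrib]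
  refine Finset.sum_le_sum fun i _ => ?_
  have h1 := (hmem i (S i)).1
  have h2 := (hmem i (S' i)).2
  have h3 := hSd i (S i)
  have h4 : 0 ≤ 1 - α := sub_nonneg.2 hα.2
  have h5 := mul_nonneg h4 h1
  have h6 := mul_le_of_le_one_right h4 h2
  linarith

end DataMarket

/-! ### Failure of confidence intervals and expected regrets -/

namespace IsZoomingPlay

section Events

variable {n k T : ℕ} {M : DataMarket n k} {α : ℝ} {Ω : Type*} {X : ℕ → Ω → Draw n k}
  {a : ℕ → Fin n → Ω → SellerSet k}

/-- The event that some confidence interval of buyer `i` is wrong. -/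
def badEvent (M : DataMarket n k) (α : ℝ) (T : ℕ) (X : ℕ → Ω → Draw n k)
    (a : ℕ → Fin n → Ω → SellerSet k) (i : Fin n) : Set Ω :=
  {ω | ¬ ∀ t < T, ∀ γ, |empMean (fun t => a t i ω) (fun s γ => M.effUtility α (X s ω) i γ) t γ
    - M.meanEffUtility α i γ| ≤ confRadius T (fun t => a t i ω) t γ}

/-- The event that `γ` was selected `m ≥ 2` times before round `t`, and that the sum of the
deviations `ξ` in these rounds is large. -/
def deviationEvent (T : ℕ) (X : ℕ → Ω → Draw n k)
    (a : ℕ → Fin n → Ω → SellerSet k) (i : Fin n) (ξ : Draw n k → ℝ) (γ : SellerSet k)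
    (t m : ℕ) : Set Ω :=
  {ω | 2 ≤ m ∧ ((Finset.range t).filter fun s => a s i ω = γ).card = m ∧
    m * Real.sqrt (12 * Real.log T / (m + 1)) ≤
      ∑ s ∈ (Finset.range t).filter (fun s => a s i ω = γ), ξ (X s ω)}

/-- With at most one observation the radius is at least 2, which bounds every possible deviation;
hence only counts `m ≥ 2` need a tail bound. -/
theorem two_le_sqrt_log (hT : 2 ≤ T) {m : ℕ} (hm : m ≤ 1) :
    2 ≤ Real.sqrt (12 * Real.log T / (m + 1)) := by
  have hL := log_ge_of_two_le hT
  have hm' : (m:ℝ) ≤ 1 := by exact_mod_cast hm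
  refine Real.le_sqrt_of_sq_le ?_
  rw [le_div_iff₀ (by positivity)]
  nlinarith

/-- The random selection count is split into its possible values `m < T`, so that each piece has a
deterministic radius. The first set is null and collects outcomes outside the almost sure range. -/
theorem badEvent_subset (hT : 2 ≤ T) (hα : α ∈ Set.Icc (0 : ℝ) 1) (i : Fin n) :
    badEvent M α T X a i ⊆
      {ω | ¬ ∀ s < T, ∀ γ, |M.effUtility α (X s ω) i γ - M.meanEffUtility α i γ| ≤ 2} ∪
      ⋃ γ ∈ (Finset.univ : Finset (SellerSet k)), ⋃ t ∈ Finset.range T, ⋃ m ∈ Finset.range T,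
        (deviationEvent T X a i (fun x => M.effUtility α x i γ - M.meanEffUtility α i γ) γ t m ∪
        deviationEvent T X a i (fun x => -(M.effUtility α x i γ - M.meanEffUtility α i γ)) γ t m)
    := by
  intro ω hω
  by_contra hcon
  rw [Set.mem_union, not_or] at hcon
  obtain ⟨hN, hE⟩ := hcon
  simp only [Set.mem_ofPred_eq, not_not] at hN
  apply hω
  intro t ht γ
  by_contra hbad
  push Not at hbad
  set u := M.meanEffUtility α i γ with hu
  set F := (Finset.range t).filter (fun s => a s i ω = γ) with hF
  have hpulls : pulls (fun t => a t i ω) t γ = F.card := rfl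
  unfold empMean confRadius at hbad
  rw [hpulls] at hbad
  rcases Nat.eq_zero_or_pos F.card with h0 | hpos
  · have h2 := two_le_sqrt_log hT (m := F.card) (by omega)
    have h3 := M.meanEffUtility_mem hα i γ
    have h4 := M.cost_mem γ
    have h5 : |u| ≤ 2 := abs_le.2 ⟨by linarith [h3.1, h4.2], by linarith [h3.2, h4.1]⟩
    have h6 : ((F.card : ℕ) : ℝ) = 0 := by exact_mod_cast h0
    rw [h6, div_zero, zero_sub, abs_neg] at hbad
    rw [h6] at h2
    linarith
  have hmpos : (0:ℝ) < F.card := by exact_mod_cast hpos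
  have hmean : (∑ s ∈ F, M.effUtility α (X s ω) i γ) / F.card - u =
      (∑ s ∈ F, (M.effUtility α (X s ω) i γ - u)) / F.card := by
    rw [Finset.sum_sub_distrib, Finset.sum_const, nsmul_eq_mul]
    field_simp
  change _ < |(∑ s ∈ F, M.effUtility α (X s ω) i γ) / F.card - u| at hbad
  rw [hmean, abs_div, Nat.abs_cast, lt_div_iff₀ hmpos] at hbad
  rcases Nat.lt_or_ge F.card 2 with h1 | h2
  · have h2 := two_le_sqrt_log hT (m := F.card) (by omega)
    have h3 : |∑ s ∈ F, (M.effUtility α (X s ω) i γ - u)| ≤ F.card * 2 := by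
      refine (Finset.abs_sum_le_sum_abs _ _).trans ?_
      rw [← nsmul_eq_mul]
      refine Finset.sum_le_card_nsmul _ _ _ fun s hs => hN s ?_ γ
      have := Finset.mem_range.1 (Finset.mem_filter.1 hs).1
      omega
    nlinarith
  · apply hE
    have hFT : F.card < T := by
      have := pulls_le (fun t => a t i ω) t γ
      omega
    simp only [Set.mem_iUnion]
    refine ⟨γ, Finset.mem_univ _, t, Finset.mem_range.2 ht, F.card, Finset.mem_range.2 hFT, ?_⟩
    rcases lt_abs.1 hbad with h | h
    · left
      exact ⟨h2, rfl, by rw [mul_comm]; exact h.le⟩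
    · right
      refine ⟨h2, rfl, ?_⟩
      rw [mul_comm, Finset.sum_neg_distrib]
      exact h.le

end Events

variable {n k T : ℕ} {M : DataMarket n k} {α lam : ℝ} {Ω : Type*} [mΩ : MeasurableSpace Ω]
  {μ : Measure Ω} {ℱ : Filtration ℕ mΩ} {X : ℕ → Ω → Draw n k}
  {A : ℕ → Fin n → Ω → Finset (SellerSet k)} {a : ℕ → Fin n → Ω → SellerSet k}

theorem measurable_draw (hp : IsZoomingPlay M α lam T μ ℱ X A a) {t : ℕ} (ht : t < T) :
    Measurable (X t) := (hp.draw_measurable t ht).mono (ℱ.le _) le_rfl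

theorem measurableSet_profile (hp : IsZoomingPlay M α lam T μ ℱ X A a) {t : ℕ} (ht : t < T)
    (S : Fin n → SellerSet k) : MeasurableSet[ℱ t] {ω | (fun j => a t j ω) = S} := by
  have : {ω | (fun j => a t j ω) = S} = ⋂ j, {ω | a t j ω = S j} := by
    ext ω
    simp [funext_iff]
  rw [this]
  exact MeasurableSet.iInter fun j => hp.order_measurable t ht j (S j)

theorem ae_deviation_le_two (hp : IsZoomingPlay M α lam T μ ℱ X A a)
    (hα : α ∈ Set.Icc (0 : ℝ) 1) (i : Fin n) :
    ∀ᵐ ω ∂μ, ∀ s < T, ∀ γ, |M.effUtility α (X s ω) i γ - M.meanEffUtility α i γ| ≤ 2 := by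
  rw [ae_all_iff]
  intro s
  by_cases hs : s < T
  · have h : ∀ᵐ ω ∂μ, ∀ γ, M.effUtility α (X s ω) i γ ∈
        Set.Icc (-1 - M.cost γ) (1 - M.cost γ) := by
      rw [ae_all_iff]
      intro γ
      have h1 := M.effUtility_mem hα i γ
      rw [← hp.draw_law s hs] at h1
      exact ae_of_ae_map (hp.measurable_draw hs).aemeasurable h1
    filter_upwards [h] with ω hω _ γ
    have h2 := M.meanEffUtility_mem hα i γ
    have h3 := hω γ
    exact abs_le.2 ⟨by linarith [h2.2, h3.1], by linarith [h2.1, h3.2]⟩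
  · exact Filter.Eventually.of_forall fun ω h => absurd h hs

variable [IsProbabilityMeasure μ]

theorem onlineEffRegret_eq (hp : IsZoomingPlay M α lam T μ ℱ X A a) (Sd : Fin n → SellerSet k)
    (i : Fin n) : onlineEffRegret M α T μ X a Sd i =
      ∫ ω, ∑ t ∈ Finset.range T,
        (M.meanEffUtility α i (Sd i) - M.meanEffUtility α i (a t i ω)) ∂μ := by
  have hg : ∀ t < T, ∀ γ, Integrable
      (fun x => M.effUtility α x i (Sd i) - M.effUtility α x i γ) (μ.map (X t)) := fun t ht γ => by
    rw [hp.draw_law t ht]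
    exact (M.integrable_effUtility i _).sub (M.integrable_effUtility i _)
  unfold onlineEffRegret
  rw [integral_finsetSum, integral_finsetSum]
  · refine Finset.sum_congr rfl fun t ht => ?_
    have ht := Finset.mem_range.1 ht
    rw [integral_selected (b := a t i)
      (g := fun γ x => M.effUtility α x i (Sd i) - M.effUtility α x i γ) (ℱ.le t)
      (hp.measurable_draw ht) (hp.draw_indep t ht) (hp.order_measurable t ht i) (hg t ht)]
    simp_rw [hp.draw_law t ht]
    refine integral_congr_ae (Filter.Eventually.of_forall fun ω => ?_)
    exact integral_sub (M.integrable_effUtility i _) (M.integrable_effUtility i _)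
  · exact fun t ht => integrable_of_selection (ℱ.le t)
      (hp.order_measurable t (Finset.mem_range.1 ht) i)
      (fun γ => M.meanEffUtility α i (Sd i) - M.meanEffUtility α i γ)
  · intro t ht
    have ht := Finset.mem_range.1 ht
    exact integrable_selected (b := a t i)
      (g := fun γ x => M.effUtility α x i (Sd i) - M.effUtility α x i γ) (ℱ.le t)
      (hp.measurable_draw ht) (hp.order_measurable t ht i) (hg t ht)

/-- The whole profile is a finite-valued choice known before the round, so each round's outcome can
be averaged out. -/
theorem onlineWelfareRegret_eq (hp : IsZoomingPlay M α lam T μ ℱ X A a)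
    (Sopt : Fin n → SellerSet k) : onlineWelfareRegret M α T μ X a Sopt =
      ∫ ω, ∑ t ∈ Finset.range T,
        (M.socialWelfare α Sopt - M.socialWelfare α (fun j => a t j ω)) ∂μ := by
  have hg : ∀ i, ∀ t < T, ∀ S, Integrable
      (fun x => M.utility α x i Sopt - M.utility α x i S) (μ.map (X t)) := fun i t ht γ => by
    rw [hp.draw_law t ht]
    exact (M.integrable_utility i _).sub (M.integrable_utility i _)
  unfold onlineWelfareRegret
  rw [integral_finsetSum]
  · have h : ∀ i, ∫ ω, ∑ t ∈ Finset.range T,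
        (M.utility α (X t ω) i Sopt - M.utility α (X t ω) i (fun j => a t j ω)) ∂μ =
        ∑ t ∈ Finset.range T, ∫ ω, (M.meanUtility α i Sopt
          - M.meanUtility α i (fun j => a t j ω)) ∂μ := by
      intro i
      rw [integral_finsetSum]
      · refine Finset.sum_congr rfl fun t ht => ?_
        have ht := Finset.mem_range.1 ht
        rw [integral_selected (b := fun ω j => a t j ω)
          (g := fun S x => M.utility α x i Sopt - M.utility α x i S) (ℱ.le t)
          (hp.measurable_draw ht) (hp.draw_indep t ht) (hp.measurableSet_profile ht) (hg i t ht)]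
        simp_rw [hp.draw_law t ht]
        refine integral_congr_ae (Filter.Eventually.of_forall fun ω => ?_)
        exact integral_sub (M.integrable_utility i _) (M.integrable_utility i _)
      · intro t ht
        have ht := Finset.mem_range.1 ht
        exact integrable_selected (b := fun ω j => a t j ω)
          (g := fun S x => M.utility α x i Sopt - M.utility α x i S) (ℱ.le t)
          (hp.measurable_draw ht) (hp.measurableSet_profile ht) (hg i t ht)
    simp_rw [h]
    rw [Finset.sum_comm]
    refine Finset.sum_congr rfl fun t ht => ?_
    rw [← integral_finsetSum]
    · simp_rw [DataMarket.socialWelfare, Finset.sum_sub_distrib]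
    · exact fun i _ => integrable_of_selection (b := fun ω j => a t j ω) (ℱ.le t)
        (hp.measurableSet_profile (Finset.mem_range.1 ht))
        (fun S => M.meanUtility α i Sopt - M.meanUtility α i S)
  · exact fun t ht => integrable_of_selection (b := fun ω j => a t j ω) (ℱ.le t)
      (hp.measurableSet_profile (Finset.mem_range.1 ht))
      (fun S => M.socialWelfare α Sopt - M.socialWelfare α S)

theorem integrable_sum_gap (hp : IsZoomingPlay M α lam T μ ℱ X A a) (Sd : Fin n → SellerSet k)
    (i : Fin n) : Integrable (fun ω => ∑ t ∈ Finset.range T,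
      (M.meanEffUtility α i (Sd i) - M.meanEffUtility α i (a t i ω))) μ :=
  integrable_finsetSum _ fun t ht => integrable_of_selection (ℱ.le t)
    (hp.order_measurable t (Finset.mem_range.1 ht) i)
    (fun γ => M.meanEffUtility α i (Sd i) - M.meanEffUtility α i γ)

theorem onlineWelfareRegret_le (hp : IsZoomingPlay M α lam T μ ℱ X A a)
    (hα : α ∈ Set.Icc (0 : ℝ) 1) {Sd : Fin n → SellerSet k} (hSd : M.IsDominantProfile α Sd)
    (Sopt : Fin n → SellerSet k) : onlineWelfareRegret M α T μ X a Sopt ≤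
      T * n * (1 - α) + ∑ i, onlineEffRegret M α T μ X a Sd i := by
  rw [hp.onlineWelfareRegret_eq]
  simp_rw [hp.onlineEffRegret_eq]
  rw [← integral_finsetSum _ fun i _ => hp.integrable_sum_gap Sd i]
  have hc : (T * n * (1 - α) : ℝ) = ∫ _, (T * n * (1 - α) : ℝ) ∂μ := by simp
  rw [hc, ← integral_add (integrable_const _)
    (integrable_finsetSum _ fun i _ => hp.integrable_sum_gap Sd i)]
  refine integral_mono ?_ ?_ fun ω => ?_
  · exact integrable_finsetSum _ fun t ht => integrable_of_selection
      (b := fun ω j => a t j ω) (ℱ.le t)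
      (hp.measurableSet_profile (Finset.mem_range.1 ht))
      (fun S => M.socialWelfare α Sopt - M.socialWelfare α S)
  · exact (integrable_const _).add
      (integrable_finsetSum _ fun i _ => hp.integrable_sum_gap Sd i)
  · simp only
    rw [Finset.sum_comm]
    have hT : (T * n * (1 - α) : ℝ) = ∑ _t ∈ Finset.range T, (n * (1 - α) : ℝ) := by
      simp [mul_assoc]
    rw [hT, ← Finset.sum_add_distrib]
    exact Finset.sum_le_sum fun t _ => M.socialWelfare_sub_le hα hSd _ _

theorem onlineEffRegret_le_three_mul (hp : IsZoomingPlay M α lam T μ ℱ X A a)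
    (hα : α ∈ Set.Icc (0 : ℝ) 1) (Sd : Fin n → SellerSet k) (i : Fin n) :
    onlineEffRegret M α T μ X a Sd i ≤ 3 * T := by
  rw [hp.onlineEffRegret_eq]
  calc _ ≤ ∫ _, (3 * T : ℝ) ∂μ := by
        refine integral_mono (hp.integrable_sum_gap Sd i) (integrable_const _) fun ω => ?_
        calc _ ≤ ∑ _t ∈ Finset.range T, (3 : ℝ) :=
              Finset.sum_le_sum fun t _ => M.gap_le_three hα i _ _
          _ = _ := by simp [mul_comm]
    _ = _ := by simp

theorem measure_deviationEvent_le (hp : IsZoomingPlay M α lam T μ ℱ X A a) (hT : 2 ≤ T)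
    (i : Fin n) (γ : SellerSet k) {ξ : Draw n k → ℝ} (hξ : Measurable ξ)
    (hsub : HasSubgaussianMGF ξ 1 M.law) {t : ℕ} (ht : t ≤ T) (m : ℕ) :
    μ (deviationEvent T X a i ξ γ t m) ≤ ENNReal.ofReal (((T:ℝ) ^ 4)⁻¹) := by
  by_cases hm : 2 ≤ m
  · have hL := log_ge_of_two_le hT
    have h := measure_selected_sum_ge_le (b := fun t => a t i) hp.draw_measurable hp.draw_indep
      (fun t ht => hp.order_measurable t ht i) γ hξ
      (fun t ht => by rw [hp.draw_law t ht]; exact hsub) ht m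
      (Real.sqrt (12 * Real.log T / (m + 1))) (Real.sqrt_nonneg _)
    refine (measure_mono fun ω hω => hω.2).trans (h.trans (ENNReal.ofReal_le_ofReal ?_))
    rw [Real.sq_sqrt (by positivity)]
    have hT0 : (0:ℝ) < T := by positivity
    have he : (((T:ℝ) ^ 4)⁻¹) = Real.exp (-(4 * Real.log T)) := by
      rw [Real.exp_neg, show 4 * Real.log T = ((4:ℕ):ℝ) * Real.log T by norm_num,
        Real.exp_nat_mul, Real.exp_log hT0]
    rw [he]
    refine Real.exp_le_exp.2 (neg_le_neg ?_)
    have hm' : (2:ℝ) ≤ m := by exact_mod_cast hm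
    -- The exponent is `6 * m / (m + 1) * log T`, and `m / (m + 1) ≥ 2/3` for `m ≥ 2`.
    rw [mul_div_assoc', div_div, le_div_iff₀ (by positivity)]
    nlinarith
  · have : deviationEvent T X a i ξ γ t m = ∅ := by
      ext ω
      simp [deviationEvent, hm]
    simp [this]

theorem measure_badEvent_le (hp : IsZoomingPlay M α lam T μ ℱ X A a) (hT : 2 ≤ T)
    (hα : α ∈ Set.Icc (0 : ℝ) 1) (i : Fin n) :
    μ (badEvent M α T X a i) ≤ ENNReal.ofReal (2 * 2 ^ k / (T:ℝ) ^ 2) := by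
  have hnull := ae_iff.1 (hp.ae_deviation_le_two hα i)
  refine (measure_mono (badEvent_subset hT hα i)).trans ?_
  refine (measure_union_le _ _).trans ?_
  rw [hnull, zero_add]
  set q : ENNReal := ENNReal.ofReal (((T:ℝ) ^ 4)⁻¹) with hq
  calc _ ≤ ∑ _γ : SellerSet k, ∑ _t ∈ Finset.range T, ∑ _m ∈ Finset.range T, (q + q) := by
        refine (measure_biUnion_finset_le _ _).trans (Finset.sum_le_sum fun γ _ => ?_)
        refine (measure_biUnion_finset_le _ _).trans (Finset.sum_le_sum fun t ht => ?_)
        refine (measure_biUnion_finset_le _ _).trans (Finset.sum_le_sum fun m _ => ?_)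
        have ht := (Finset.mem_range.1 ht).le
        have hξ := (M.measurable_effUtility (α := α) i γ).sub_const (M.meanEffUtility α i γ)
        have hsub := M.hasSubgaussianMGF_effUtility hα i γ
        refine (measure_union_le _ _).trans (add_le_add ?_ ?_)
        · exact hp.measure_deviationEvent_le hT i γ hξ hsub ht m
        · exact hp.measure_deviationEvent_le hT i γ hξ.neg hsub.neg ht m
    _ = ENNReal.ofReal (2 * 2 ^ k / (T:ℝ) ^ 2) := by
        have hT0 : (0:ℝ) < T := by positivity
        rw [hq, ← ENNReal.ofReal_add (by positivity) (by positivity)]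
        simp only [Finset.sum_const, Finset.card_univ, Finset.card_range, Fintype.card_finset,
          Fintype.card_fin, ← ENNReal.ofReal_nsmul]
        congr 1
        simp only [nsmul_eq_mul]
        push_cast
        field_simp
        ring

theorem onlineEffRegret_le_of_good (hp : IsZoomingPlay M α lam T μ ℱ X A a) (hT : 2 ≤ T)
    (hα : α ∈ Set.Icc (0 : ℝ) 1) (Sd : Fin n → SellerSet k) (i : Fin n) {b : ℝ} (hb : 0 ≤ b)
    (hgood : ∀ ω, ω ∉ badEvent M α T X a i → ∑ t ∈ Finset.range T,
      (M.meanEffUtility α i (Sd i) - M.meanEffUtility α i (a t i ω)) ≤ b) :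
    onlineEffRegret M α T μ X a Sd i ≤ b + 6 * 2 ^ k / T := by
  rw [hp.onlineEffRegret_eq]
  -- A measurable hull of the same measure avoids proving the bad event measurable.
  set N := toMeasurable μ (badEvent M α T X a i) with hN
  have hNm : MeasurableSet N := measurableSet_toMeasurable _ _
  have hT0 : (0:ℝ) < T := by positivity
  have hμ : μ.real N ≤ 2 * 2 ^ k / (T:ℝ) ^ 2 := by
    rw [Measure.real, hN, measure_toMeasurable]
    exact ENNReal.toReal_le_of_le_ofReal (by positivity) (hp.measure_badEvent_le hT hα i)
  calc _ ≤ ∫ ω, (b + N.indicator (fun _ => (3 * T : ℝ)) ω) ∂μ := by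
        refine integral_mono (hp.integrable_sum_gap Sd i)
          ((integrable_const _).add ((integrable_const _).indicator hNm)) fun ω => ?_
        by_cases hω : ω ∈ N
        · simp only [Set.indicator_of_mem hω]
          calc _ ≤ ∑ _t ∈ Finset.range T, (3 : ℝ) :=
                Finset.sum_le_sum fun t _ => M.gap_le_three hα i _ _
            _ = 3 * T := by simp [mul_comm]
            _ ≤ _ := by linarith
        · simp only [Set.indicator_of_notMem hω, add_zero]
          exact hgood ω fun h => hω (subset_toMeasurable _ _ h)
    _ = b + μ.real N * (3 * T) := by
        rw [integral_add (integrable_const _) ((integrable_const _).indicator hNm),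
          integral_indicator hNm]
        simp
    _ ≤ b + (2 * 2 ^ k / (T:ℝ) ^ 2) * (3 * T) := by gcongr
    _ = _ := by field_simp; ring

end IsZoomingPlay

/-! ### Regret of one buyer and the final bounds -/

theorem IsZoomingPlay.onlineEffRegret_le {n k T : ℕ} {M : DataMarket n k} {α lam : ℝ}
    {Ω : Type*} [mΩ : MeasurableSpace Ω] {μ : Measure Ω} [IsProbabilityMeasure μ]
    {ℱ : Filtration ℕ mΩ} {X : ℕ → Ω → Draw n k} {A : ℕ → Fin n → Ω → Finset (SellerSet k)}
    {a : ℕ → Fin n → Ω → SellerSet k} (hp : IsZoomingPlay M α lam T μ ℱ X A a)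
    (hlam : 0 < lam) (hk : 1 ≤ k) (hT : 2 ≤ T) (hα : α ∈ Set.Icc (0 : ℝ) 1)
    {Sd : Fin n → SellerSet k} (hSd : M.IsDominantProfile α Sd) (hclose : M.Closeness α lam Sd)
    (i : Fin n) :
    onlineEffRegret M α T μ X a Sd i ≤ (41 + 3 * Real.exp (lam ^ 2 / 12) + 6500 / lam) *
      ((k : ℝ) ^ 2 * Real.sqrt (T * Real.log T) +
        (k : ℝ) ^ 3 * (Real.log T) ^ 2 * (2 : ℝ) ^ (3 * (k : ℝ) / 4)) := by
  have hL := log_ge_of_two_le hT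
  have hk1 : (1:ℝ) ≤ k := by exact_mod_cast hk
  have hT2 : (2:ℝ) ≤ T := by exact_mod_cast hT
  have hT0 : (0:ℝ) < T := by linarith
  set L := Real.log T with hLdef
  set Q : ℝ := (2 : ℝ) ^ (3 * (k : ℝ) / 4) with hQ
  set s := Real.sqrt (T * L) with hs
  have hQ0 : 0 < Q := by positivity
  have hs1 : 1 ≤ s := Real.le_sqrt_of_sq_le (by nlinarith)
  have hkS : k * s ≤ (k:ℝ) ^ 2 * s := by
    have : (k:ℝ) ≤ k ^ 2 := by nlinarith
    gcongr
  have hS1 : 1 ≤ (k:ℝ) ^ 2 * s := by nlinarith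
  have hkW : (k:ℝ) ^ 2 * L * Q * 0.69 ≤ (k:ℝ) ^ 3 * L ^ 2 * Q := by
    have h1 : (k:ℝ) ^ 2 ≤ k ^ 3 := pow_le_pow_right₀ hk1 (by norm_num)
    calc (k:ℝ) ^ 2 * L * Q * 0.69 = (k:ℝ) ^ 2 * (L * 0.69) * Q := by ring
      _ ≤ (k:ℝ) ^ 3 * L ^ 2 * Q := by gcongr; nlinarith
  have hQW : Q * 0.47 ≤ (k:ℝ) ^ 3 * L ^ 2 * Q := by
    have h1 : (1:ℝ) ≤ (k:ℝ) ^ 3 := one_le_pow₀ hk1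
    have h2 : (0.47:ℝ) ≤ L ^ 2 := by nlinarith
    calc Q * 0.47 = 1 * 0.47 * Q := by ring
      _ ≤ (k:ℝ) ^ 3 * L ^ 2 * Q := by gcongr
  set S := (k:ℝ) ^ 2 * s with hS
  set W := (k:ℝ) ^ 3 * L ^ 2 * Q with hW
  have hW0 : 0 ≤ W := by positivity
  have hS0 : 0 ≤ S := by linarith
  have he : 0 < Real.exp (lam ^ 2 / 12) := Real.exp_pos _
  have hl : 0 < 6500 / lam := by positivity
  have hexpS := mul_nonneg he.le hS0
  have hexpW := mul_nonneg he.le hW0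
  have hlS := mul_nonneg hl.le hS0
  have hlW := mul_nonneg hl.le hW0
  -- Short horizons: `3 * T` is below `3 * Q`, which the last term of the bound absorbs.
  by_cases hc1 : (T:ℝ) < Q
  · have := hp.onlineEffRegret_le_three_mul hα Sd i
    linarith
  -- Here one activation per round need not cover everything, but `T ≤ exp (lam² / 12)`, a constant
  -- depending only on `lam`.
  by_cases hc2 : Real.sqrt (12 * L) < lam
  · have h1 := hp.onlineEffRegret_le_three_mul hα Sd i
    have h2 : 12 * L < lam ^ 2 := (Real.sqrt_lt' hlam).1 hc2
    have h3 : (T:ℝ) ≤ Real.exp (lam ^ 2 / 12) := by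
      rw [← Real.log_le_iff_le_exp hT0]
      linarith
    have h4 := le_mul_of_one_le_right he.le hS1
    linarith
  push Not at hc1 hc2
  have hreg := hp.onlineEffRegret_le_of_good hT hα Sd i
    (b := 2 * k * Real.sqrt (108 * (T * L)) + k * (40 * Q) * (108 * L * k / lam))
    (by positivity) (fun ω hω => by
      simp only [badEvent, Set.mem_ofPred_eq, not_not] at hω
      exact (hp.zooming i ω).sum_gap_le hlam hT hk hc2 hω (fun γ => (hclose i γ).2)
        (fun γ => (hclose i γ).1) (hSd i) (fun γ => M.gap_le_three hα i _ _))
  have h1 : Real.sqrt (108 * (T * L)) ≤ 10.5 * s := by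
    rw [Real.sqrt_mul (by norm_num)]
    gcongr
    exact Real.sqrt_le_iff.2 ⟨by norm_num, by norm_num⟩
  have h2 : 2 * k * Real.sqrt (108 * (T * L)) ≤ 21 * S := by
    calc 2 * k * Real.sqrt (108 * (T * L)) ≤ 2 * k * (10.5 * s) := by gcongr
      _ = 21 * (k * s) := by ring
      _ ≤ 21 * S := by gcongr
  have h3 : k * (40 * Q) * (108 * L * k / lam) ≤ 6500 / lam * W := by
    calc k * (40 * Q) * (108 * L * k / lam) = 4320 / lam * ((k:ℝ) ^ 2 * L * Q) := by ring
      _ ≤ 4320 / lam * (W / 0.69) := by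
          gcongr
          rw [le_div_iff₀ (by norm_num)]
          exact hkW
      _ = (4320 / 0.69) / lam * W := by ring
      _ ≤ 6500 / lam * W := by gcongr; norm_num
  have h4 : 6 * 2 ^ k / (T:ℝ) ≤ 6 * Q := by
    rw [div_le_iff₀ hT0]
    -- As `Q² = 2^(3k/2) ≥ 2^k` and `T ≥ Q`, the failure term is at most `6 * Q`.
    have h5 : (2:ℝ) ^ k ≤ Q * Q := by
      rw [hQ, ← Real.rpow_add (by norm_num), ← Real.rpow_natCast]
      exact Real.rpow_le_rpow_of_exponent_le (by norm_num) (by linarith)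
    have h6 : Q * Q ≤ Q * T := by gcongr
    linarith
  linarith

theorem mainTheorem3 :
    ∃ C₀ : ℝ, 0 < C₀ ∧ ∀ lam : ℝ, 0 < lam → ∃ C : ℝ, 0 < C ∧
      ∀ (n k T : ℕ), 1 ≤ k → 2 ≤ T → ∀ α ∈ Set.Icc (0 : ℝ) 1,
      ∀ (M : DataMarket n k) (Sd Sopt : Fin n → SellerSet k),
        M.IsDominantProfile α Sd → M.Closeness α lam Sd → M.IsSocialOptimum α Sopt →
      ∀ (Ω : Type*) (mΩ : MeasurableSpace Ω) (μ : Measure Ω) (_ : IsProbabilityMeasure μ)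
        (ℱ : Filtration ℕ mΩ) (X : ℕ → Ω → Draw n k)
        (A : ℕ → Fin n → Ω → Finset (SellerSet k)) (a : ℕ → Fin n → Ω → SellerSet k),
        IsZoomingPlay M α lam T μ ℱ X A a →
        onlineWelfareRegret M α T μ X a Sopt
            ≤ C₀ * (T * n * (1 - α)) + ∑ i, onlineEffRegret M α T μ X a Sd i ∧
        C₀ * (T * n * (1 - α)) + ∑ i, onlineEffRegret M α T μ X a Sd i
            ≤ C * (T * n * (1 - α) + n * (k : ℝ) ^ 2 * Real.sqrt (T * Real.log T)
                + n * (k : ℝ) ^ 3 * (Real.log T) ^ 2 * (2 : ℝ) ^ (3 * (k : ℝ) / 4)) := by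
  refine ⟨1, one_pos, fun lam hlam =>
    ⟨41 + 3 * Real.exp (lam ^ 2 / 12) + 6500 / lam, by positivity, ?_⟩⟩
  intro n k T hk hT α hα M Sd Sopt hSd hclose _ Ω mΩ μ hμ ℱ X A a hp
  rw [one_mul]
  refine ⟨hp.onlineWelfareRegret_le hα hSd Sopt, ?_⟩
  set K := 41 + 3 * Real.exp (lam ^ 2 / 12) + 6500 / lam with hK
  set B := (k : ℝ) ^ 2 * Real.sqrt (T * Real.log T) +
    (k : ℝ) ^ 3 * (Real.log T) ^ 2 * (2 : ℝ) ^ (3 * (k : ℝ) / 4) with hB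
  have hK1 : 1 ≤ K := by
    have h1 : 0 < Real.exp (lam ^ 2 / 12) := Real.exp_pos _
    have h2 : 0 < 6500 / lam := by positivity
    linarith
  have hsum : ∑ i, onlineEffRegret M α T μ X a Sd i ≤ n * (K * B) := by
    calc _ ≤ ∑ _i : Fin n, K * B :=
          Finset.sum_le_sum fun i _ => hp.onlineEffRegret_le hlam hk hT hα hSd hclose i
      _ = _ := by simp
  have h0 : 0 ≤ (T:ℝ) * n * (1 - α) := mul_nonneg (by positivity) (sub_nonneg.2 hα.2)
  calc _ ≤ K * (T * n * (1 - α)) + n * (K * B) :=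
        add_le_add (le_mul_of_one_le_left h0 hK1) hsum
    _ = _ := by rw [hB]; ring
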